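/- Notation. $BS(1,2)=\langle a,t\mid t^{-1}at=a^2\rangle$, and $\Phi:BS(1,2)\to\mathbb R^2$ is given by $\Phi(t^ia^jt^{-k})=(j2^{-i},k-i)$ $(i,k\ge 0,\ j\in\mathbb Z)$. The group $G=BS(1,2)$ acts on configurations $x:G\to B$ ($B$ finite) by $(\mathfrak S_gx)_h=x_{g^{-1}h}$; a set of configurations is strongly aperiodic if each of its elements has trivial stabilizer, and it is an SFT if it is the set of configurations avoiding some finite set of finite patterns. Let $\mathcal A$ be a finite alphabet with $|\mathcal A|\ge 2$, let $\sigma:\mathcal A\to\mathcal A^*$ be a primitive substitution with incidence matrix $M_\sigma$, and let $\lambda>1$, $v\in(\mathbb R_{>0})^{\mathcal A}$ satisfy $M_\sigma v=\lambda v$, with $\lambda\ge 8$ and $v(a)\ge 3$ for all $a\in\mathcal A$. Definition of $Y_\sigma$. The $a$-tile in position $(x,y)$ is $[x,x+v(a)2^y]\times[y-\log_2\lambda,y]$; if $\sigma(a)=w_1\dots w_k$, its bottom side is divided from left to right into edges of lengths $\frac1\lambda v(w_i)2^y$ labelled $w_1,\dots,w_k$, and its top edge is labelled $a$. A $\sigma$-tiling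 is a set of such tiles (for all $a$ and all real positions) that covers $\mathbb R^2$, has pairwise disjoint interiors, and in which the $i$-th bottom edge of every $a$-tile is the top edge of a $w_i$-tile of the tiling. It is identified with the maps $\tau:\mathbb R^2\to\mathcal A$ that send every point to the letter of some tile containing it. $Y_\sigma$ is the set of all $y\in\mathcal A^{G}$ such that $y_g=\tau(\Phi(gat))$ for all $g\in G$, for some $\sigma$-tiling $\tau$. Definition of $X_\sigma$. Put $h=\lfloor\log_2\lambda\rfloor-1$, $M=\max_a|\sigma(a)|$, and fix integers $0\le \ell_a,u_a$ $(a\in\mathcal A)$, the bounds on the top widths of shaded zones. The alphabet $\mathcal R$ of $X_\sigma$ consists of the pentagonal Wang tiles $t_1(b,j,a,i),t_2,t_3,t_4$ (top letters), $m_1,\,m_2(b,j,a,i),m_3,m_4,m_5$ (middle letters), $b_1,b_2,b_3$ (bottom letters), each other letter carrying one pair $(a,i)$; $a,b\in\mathcal A$, $1\le i,j\le M$. Their edges are coloured as follows, where $\cdot$ is white, $F$ completely shaded, $1$ (resp. $2$) shaded on the left/lower (resp. right/upper) half; every shaded edge also carries $(a,i)$, except the edges marked $'$, which carry $(b,j)$: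 $$\begin{array}{c|ccccc} &\text{top}&\text{left}&\text{right}&\text{bottom left}&\text{bottom right}\\\hline t_1&\cdot&1'&1&1'&2\\ t_2&\cdot&\cdot&1&2&F\\ t_3&\cdot&1&1&F&F\\ t_4&\cdot&1&\cdot&F&1\\ m_1&2&\cdot&F&2&F\\ m_2&2&1'&F&1'&2\\ m_3&F&F&F&F&F\\ m_4&1&F&\cdot&F&1\\ m_5&1&F&1&F&F\\ b_1&2&\cdot&2&\cdot&\cdot\\ b_2&F&2&2&\cdot&\cdot\\ b_3&1&2&\cdot&\cdot&\cdot\end{array}$$ $X_\sigma\subset\mathcal R^{G}$ is the set of configurations $x$ satisfying, for all $g\in G$: 1. the right edge of $x_g$ matches the left edge of $x_{ga}$, and the bottom left and bottom right edges of $x_g$ match the top edges of $x_{gt}$ and $x_{gta}$ respectively; 2. $x_g$ and $x_{ga}$ have the same type (top, middle or bottom); 3. (heights) if $x_g$ is a top letter, then along $gt,gt^2,\dots$ there are exactly $n$ middle letters followed by a bottom letter, with $n\in\{h-1,h\}$, and one of $x_g,x_{gt},\dots,x_{gt^{h+1}}$ is a top letter; (widths) in a row immediately below a row of top letters, every shaded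 zone with letter $a$ starts with a letter $m_1$ or $m_2$ with right-hand information $(a,i)$, which is followed along the generator $a$ by exactly $r$ letters $m_3(a,i)$ and then by $m_4(a,i)$ or $m_5(a,i)$, where $\ell_a\le r\le u_a$, and there are never more than $u_a$ consecutive letters $m_3(a,i)$; 4. $x_g=t_1(b,j,a,i)$ implies $x_{gtat^{-1}}=t_2(a,i)$ and $x_{gta^{-1}t^{-1}}=t_4(b,j)$; for $\beta\in\{b_1,b_3\}$, $x_g=\beta(a,i)$ implies $x_{gtat^{-1}}=\beta(a,i)$ or $x_{gta^{-1}t^{-1}}=\beta(a,i)$; and $x_g=m_1(a,i)$ if and only if $x_{gta^{-1}t^{-1}}=m_2(b,j,a,i)$ for some $b,j$; 5. if a shaded area carries the letter $a$, then the shaded areas immediately below it carry $(a_1,1),\dots,(a_k,k)$ in this order, where $\sigma(a)=a_1\dots a_k$. Precisely: if $x_g=b_1(a,i)$, there is $l\ge2$ with $l\le 2^h(u_a+3)$ (a bound implied by rule 3) such that $x_{ga},\dots,x_{ga^{l-2}}$ are $b_2(a,i)$ and $x_{ga^{l-1}}=b_3(a,i)$; for each of $g'=g$ and $g'=ga^l$,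 exactly one of $x_{g't},x_{g'ta}$ is a letter $t_1$ or $t_2$ with right-hand index $1$; and the letters $t_1,t_2$ met along $a$ from the one below $g$ (included) to the one below $ga^l$ (excluded) carry successively the right-hand informations $(a_1,1),\dots,(a_k,k)$. Theorem. If $\log_2\lambda$ is irrational, then every configuration of $Y_\sigma$ has trivial stabilizer, that is, $Y_\sigma$ is strongly aperiodic; and, for every choice of the bounds $\ell_a,u_a$, the set $X_\sigma$ is an SFT and is strongly aperiodic on $BS(1,2)$. -/

import Mathlib

namespace SigmaShift

/-! ### Subshifts on a group -/

section Subshifts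

variable {G B : Type*} [Group G]

/-- The shift action of `G` on the configurations `G → B`: `(shift g x) h = x (g⁻¹ h)`. -/
def shift (g : G) (x : G → B) : G → B := fun h => x (g⁻¹ * h)

/-- The stabilizer of a configuration under the shift action. -/
def stab (x : G → B) : Set G := {g | shift g x = x}

/-- A set of configurations is strongly aperiodic if all its elements have a trivial stabilizer. -/
def StronglyAperiodic (X : Set (G → B)) : Prop := ∀ x ∈ X, stab x = {1}

/-- The pattern `p` with finite support `S` appears in `x`. -/
def Appears (S : Finset G) (p : S → B) (x : G → B) : Prop :=
  ∃ g : G, ∀ h : S, p h = shift g x h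

/-- A subshift of finite type: the configurations that avoid a finite set of patterns. -/
def IsSFT (X : Set (G → B)) : Prop :=
  ∃ F : Set (Σ S : Finset G, (S → B)), F.Finite ∧ X = {x | ∀ p ∈ F, ¬ Appears p.1 p.2 x}

end Subshifts

/-! ### The Baumslag-Solitar group `BS(1,2)` and the map `Φ` -/

/-- The two generators. -/
inductive Gen
  | a
  | t

/-- The defining relator of `⟨a, t ∣ t⁻¹ a t = a²⟩`. -/
def rels : Set (FreeGroup Gen) :=
  {(FreeGroup.of Gen.t)⁻¹ * FreeGroup.of Gen.a * FreeGroup.of Gen.t * (FreeGroup.of Gen.a ^ 2)⁻¹}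

/-- The Baumslag-Solitar group `BS(1,2) = ⟨a, t ∣ t⁻¹ a t = a²⟩`. -/
abbrev BS : Type := PresentedGroup rels

/-- The generator `a`. -/
def ga : BS := PresentedGroup.of Gen.a

/-- The generator `t`. -/
def gt : BS := PresentedGroup.of Gen.t

/-- Left multiplication by the images `(1, 0)` and `(0, -1)` of `a` and `t` for the law
`(x, n) (x', n') = (x + 2 ^ n x', n + n')`. -/
noncomputable def genAct : Gen → Equiv.Perm (ℝ × ℤ)
  | Gen.a =>
    { toFun := fun p => (1 + p.1, p.2)
      invFun := fun p => (-1 + p.1, p.2)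
      left_inv := fun p => by simp
      right_inv := fun p => by simp }
  | Gen.t =>
    { toFun := fun p => (p.1 / 2, p.2 - 1)
      invFun := fun p => (p.1 * 2, p.2 + 1)
      left_inv := fun p => by simp
      right_inv := fun p => by simp }

theorem genAct_rels : ∀ r ∈ rels, FreeGroup.lift genAct r = 1 := by
  intro r hr
  rw [rels, Set.mem_singleton_iff] at hr
  subst hr
  rw [map_mul, mul_eq_one_iff_eq_inv, map_inv, inv_inv]
  ext p
  · simp [genAct, pow_two, Equiv.Perm.mul_apply, Equiv.Perm.inv_def, Equiv.symm]
    ring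
  · simp [genAct, pow_two, Equiv.Perm.mul_apply, Equiv.Perm.inv_def, Equiv.symm]

/-- The action of `BS(1,2)` on `ℝ × ℤ` by left multiplication in the semidirect product. -/
noncomputable def act : BS →* Equiv.Perm (ℝ × ℤ) := PresentedGroup.toGroup genAct_rels

/-- The map `Φ`, with values in `ℝ²`. -/
noncomputable def Phi (g : BS) : ℝ × ℝ := ((act g (0, 0)).1, ((act g (0, 0)).2 : ℝ))

theorem act_ga (p : ℝ × ℤ) : act ga p = (1 + p.1, p.2) := by
  simp [act, ga, genAct]

theorem act_gt (p : ℝ × ℤ) : act gt p = (p.1 / 2, p.2 - 1) := by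
  simp [act, gt, genAct]

theorem act_gt_pow (i : ℕ) (p : ℝ × ℤ) : act (gt ^ i) p = (p.1 / 2 ^ i, p.2 - i) := by
  induction i generalizing p with
  | zero => simp
  | succ i ih =>
    rw [pow_succ, map_mul, Equiv.Perm.mul_apply, act_gt, ih]
    ext
    · simp only; rw [pow_succ, div_div, mul_comm]
    · simp only; push_cast; ring

theorem act_gt_inv_pow (i : ℕ) (p : ℝ × ℤ) : act (gt ^ i)⁻¹ p = (p.1 * 2 ^ i, p.2 + i) := by
  rw [map_inv, Equiv.Perm.inv_eq_iff_eq, act_gt_pow]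
  ext <;> simp

theorem act_ga_pow (j : ℕ) (p : ℝ × ℤ) : act (ga ^ j) p = (j + p.1, p.2) := by
  induction j generalizing p with
  | zero => simp
  | succ j ih =>
    rw [pow_succ, map_mul, Equiv.Perm.mul_apply, act_ga, ih]
    ext
    · simp only; push_cast; ring
    · rfl

theorem act_ga_zpow (j : ℤ) (p : ℝ × ℤ) : act (ga ^ j) p = (j + p.1, p.2) := by
  obtain ⟨n, rfl | rfl⟩ := j.eq_nat_or_neg
  · rw [zpow_natCast, act_ga_pow]; simp
  · rw [zpow_neg, zpow_natCast, map_inv, Equiv.Perm.inv_eq_iff_eq, act_ga_pow]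
    ext <;> simp

/-- `Φ (tⁱ aʲ t⁻ᵏ) = (j 2⁻ⁱ, k - i)`. -/
theorem Phi_normalForm (i k : ℕ) (j : ℤ) :
    Phi (gt ^ i * ga ^ j * (gt ^ k)⁻¹) = ((j : ℝ) / 2 ^ i, (k : ℝ) - i) := by
  rw [Phi, map_mul, map_mul, Equiv.Perm.mul_apply, Equiv.Perm.mul_apply, act_gt_inv_pow,
    act_ga_zpow, act_gt_pow]
  simp

/-! ### Substitutions and `σ`-tilings -/

section Substitution

variable {A : Type*} [Fintype A] [DecidableEq A]

/-- The incidence matrix of a substitution. -/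
def incidence (σ : A → List A) : Matrix A A ℕ := Matrix.of fun a b => (σ a).count b

/-- Some power of the incidence matrix has only positive entries. -/
def IsPrimitive (σ : A → List A) : Prop := ∃ k : ℕ, ∀ a b, 0 < (incidence σ ^ k) a b

/-- `lam > 1` is an expanding eigenvalue of `σ` with positive eigenvector `v`. -/
def IsExpanding (σ : A → List A) (lam : ℝ) (v : A → ℝ) : Prop :=
  1 < lam ∧ (∀ a, 0 < v a) ∧ ((incidence σ).map (fun n : ℕ => (n : ℝ))).mulVec v = lam • v

/-- The unique size property. -/
def UniqueSize (lam : ℝ) (v : A → ℝ) : Prop := 8 ≤ lam ∧ ∀ a, 3 ≤ v a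

/-- The (closed) tile `p = (a, x, y)`, that is, the `a`-tile in position `(x, y)`. -/
def tile (lam : ℝ) (v : A → ℝ) (p : A × ℝ × ℝ) : Set (ℝ × ℝ) :=
  Set.Icc p.2.1 (p.2.1 + v p.1 * (2 : ℝ) ^ p.2.2) ×ˢ
    Set.Icc (p.2.2 - Real.logb 2 lam) p.2.2

/-- A tiling of the plane by `σ`-tiles: the tiles cover the plane, have pairwise disjoint
interiors, and the `i`-th bottom edge of an `a`-tile, which carries the `i`-th letter of `σ a`,
is the top edge of a tile of that letter. -/
structure IsTiling (σ : A → List A) (lam : ℝ) (v : A → ℝ) (T : Set (A × ℝ × ℝ)) : Prop where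
  cover : (⋃ p ∈ T, tile lam v p) = Set.univ
  disjoint : T.Pairwise fun p q => Disjoint (interior (tile lam v p)) (interior (tile lam v q))
  subst : ∀ a x y, (a, x, y) ∈ T → ∀ (i : ℕ) (hi : i < (σ a).length),
    ((σ a)[i], x + (((σ a).take i).map v).sum / lam * (2 : ℝ) ^ y, y - Real.logb 2 lam) ∈ T

/-- A `σ`-tiling seen as a map `ℝ² → A`: each point is sent to the letter of a tile that
contains it. No convention is imposed on the points that lie on several tiles. -/
def IsTilingMap (σ : A → List A) (lam : ℝ) (v : A → ℝ) (τ : ℝ × ℝ → A) : Prop :=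
  ∃ T, IsTiling σ lam v T ∧ ∀ z, ∃ p ∈ T, z ∈ tile lam v p ∧ τ z = p.1

/-- `Y_σ`: the configurations `y` with `y g = τ (Φ (g a t))` for some `σ`-tiling `τ`. -/
def YSigma (σ : A → List A) (lam : ℝ) (v : A → ℝ) : Set (BS → A) :=
  {y | ∃ τ, IsTilingMap σ lam v τ ∧ ∀ g, y g = τ (Phi (g * ga * gt))}

end Substitution

/-! ### The alphabet of `X_σ`

Every letter is a pentagonal Wang tile (one top, one left, one right and two bottom edges). The
index `i : Fin m` of a shaded area is counted from `0`. In `t1 b j a i` and `m2 b j a i`, `(b, j)`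
belongs to the left shaded area and `(a, i)` to the right one. -/

inductive Letter (A : Type*) (m : ℕ)
  | t1 (b : A) (j : Fin m) (a : A) (i : Fin m)
  | t2 (a : A) (i : Fin m)
  | t3 (a : A) (i : Fin m)
  | t4 (a : A) (i : Fin m)
  | m1 (a : A) (i : Fin m)
  | m2 (b : A) (j : Fin m) (a : A) (i : Fin m)
  | m3 (a : A) (i : Fin m)
  | m4 (a : A) (i : Fin m)
  | m5 (a : A) (i : Fin m)
  | b1 (a : A) (i : Fin m)
  | b2 (a : A) (i : Fin m)
  | b3 (a : A) (i : Fin m)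

/-- The three types of letters: top, middle, bottom. -/
inductive Kind
  | top
  | mid
  | bot

/-- Colors of edges: not shaded, completely shaded, or half shaded; `fstHalf` is the left half of a
horizontal edge or the lower half of a vertical edge, `sndHalf` is the other half. -/
inductive Color (A : Type*) (m : ℕ)
  | white
  | full (a : A) (i : Fin m)
  | fstHalf (a : A) (i : Fin m)
  | sndHalf (a : A) (i : Fin m)

namespace Letter

variable {A : Type*} {m : ℕ}

def kind : Letter A m → Kind
  | t1 .. | t2 .. | t3 .. | t4 .. => .top
  | m1 .. | m2 .. | m3 .. | m4 .. | m5 .. => .mid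
  | b1 .. | b2 .. | b3 .. => .bot

def topEdge : Letter A m → Color A m
  | t1 .. | t2 .. | t3 .. | t4 .. => .white
  | m1 a i => .sndHalf a i
  | m2 _ _ a i => .sndHalf a i
  | m3 a i => .full a i
  | m4 a i => .fstHalf a i
  | m5 a i => .fstHalf a i
  | b1 a i => .sndHalf a i
  | b2 a i => .full a i
  | b3 a i => .fstHalf a i

def leftEdge : Letter A m → Color A m
  | t1 b j _ _ => .fstHalf b j
  | t2 _ _ => .white
  | t3 a i => .fstHalf a i
  | t4 a i => .fstHalf a i
  | m1 _ _ => .white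
  | m2 b j _ _ => .fstHalf b j
  | m3 a i => .full a i
  | m4 a i => .full a i
  | m5 a i => .full a i
  | b1 _ _ => .white
  | b2 a i => .sndHalf a i
  | b3 a i => .sndHalf a i

def rightEdge : Letter A m → Color A m
  | t1 _ _ a i => .fstHalf a i
  | t2 a i => .fstHalf a i
  | t3 a i => .fstHalf a i
  | t4 _ _ => .white
  | m1 a i => .full a i
  | m2 _ _ a i => .full a i
  | m3 a i => .full a i
  | m4 _ _ => .white
  | m5 a i => .fstHalf a i
  | b1 a i => .sndHalf a i
  | b2 a i => .sndHalf a i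
  | b3 _ _ => .white

/-- The left one of the two bottom edges. -/
def botLeft : Letter A m → Color A m
  | t1 b j _ _ => .fstHalf b j
  | t2 a i => .sndHalf a i
  | t3 a i => .full a i
  | t4 a i => .full a i
  | m1 a i => .sndHalf a i
  | m2 b j _ _ => .fstHalf b j
  | m3 a i => .full a i
  | m4 a i => .full a i
  | m5 a i => .full a i
  | b1 .. | b2 .. | b3 .. => .white

/-- The right one of the two bottom edges. -/
def botRight : Letter A m → Color A m
  | t1 _ _ a i => .sndHalf a i
  | t2 a i => .full a i
  | t3 a i => .full a i
  | t4 a i => .fstHalf a i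
  | m1 a i => .full a i
  | m2 _ _ a i => .sndHalf a i
  | m3 a i => .full a i
  | m4 a i => .fstHalf a i
  | m5 a i => .full a i
  | b1 .. | b2 .. | b3 .. => .white

/-- The letter and the index of the shaded area whose top left corner is in the Wang tile. -/
def corner : Letter A m → Option (A × ℕ)
  | t1 _ _ a i => some (a, i)
  | t2 a i => some (a, i)
  | _ => none

end Letter

/-! ### The local rules of `X_σ` -/

section Rules

variable {A : Type*} {m : ℕ}

/-- Rule 1: the colors of edges match along the generators. -/
def Matching (x : BS → Letter A m) : Prop :=
  ∀ g, (x g).rightEdge = (x (g * ga)).leftEdge ∧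
    (x g).botLeft = (x (g * gt)).topEdge ∧
    (x g).botRight = (x (g * gt * ga)).topEdge

/-- Rule 2: the type of letters is constant on every set `{g aᵏ ∣ k ∈ ℤ}`. -/
def UniformKind (x : BS → Letter A m) : Prop :=
  ∀ g, (x (g * ga)).kind = (x g).kind

/-- Rule 3, heights: a shaded zone has `h` or `h - 1` completely shaded rows, and no shaded zone is
infinite in the vertical direction. -/
def Heights (h : ℕ) (x : BS → Letter A m) : Prop :=
  (∀ g, (x g).kind = .top → ∃ n, (n = h ∨ n + 1 = h) ∧
    (∀ k, 1 ≤ k → k ≤ n → (x (g * gt ^ k)).kind = .mid) ∧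
    (x (g * gt ^ (n + 1))).kind = .bot) ∧
  ∀ g, ∃ k ≤ h + 1, (x (g * gt ^ k)).kind = .top

/-- The element `u` is in a row immediately below a row of top letters. -/
def InTopRow (x : BS → Letter A m) (u : BS) : Prop :=
  (x (u * gt⁻¹)).kind = .top ∨ (x (u * ga⁻¹ * gt⁻¹)).kind = .top

/-- Rule 3, widths: the number of completely shaded letters in the first completely shaded row of a
shaded zone with letter `a` is between `lo a` and `hi a`, and no shaded zone is infinite in the
horizontal direction. -/
def Widths (lo hi : A → ℕ) (x : BS → Letter A m) : Prop :=
  ∀ u, InTopRow x u → ∀ a i,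
    ((x u = .m1 a i ∨ ∃ b j, x u = .m2 b j a i) →
      ∃ r, lo a ≤ r ∧ r ≤ hi a ∧ (∀ k, 1 ≤ k → k ≤ r → x (u * ga ^ k) = .m3 a i) ∧
        (x (u * ga ^ (r + 1)) = .m4 a i ∨ x (u * ga ^ (r + 1)) = .m5 a i)) ∧
    ¬ ∀ k ≤ hi a, x (u * ga ^ k) = .m3 a i

/-- Rule 4: the letters in `g`, `g t a t⁻¹` and `g t a⁻¹ t⁻¹` are synchronized. -/
def Synchronized (x : BS → Letter A m) : Prop :=
  (∀ g b j a i, x g = .t1 b j a i →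
    x (g * gt * ga * gt⁻¹) = .t2 a i ∧ x (g * gt * ga⁻¹ * gt⁻¹) = .t4 b j) ∧
  (∀ g a i, x g = .b1 a i →
    x (g * gt * ga * gt⁻¹) = .b1 a i ∨ x (g * gt * ga⁻¹ * gt⁻¹) = .b1 a i) ∧
  (∀ g a i, x g = .b3 a i →
    x (g * gt * ga * gt⁻¹) = .b3 a i ∨ x (g * gt * ga⁻¹ * gt⁻¹) = .b3 a i) ∧
  (∀ g a i, x g = .m1 a i ↔ ∃ b j, x (g * gt * ga⁻¹ * gt⁻¹) = .m2 b j a i)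

/-- Among the two letters `x (g t)` and `x (g t a)` below `g`, exactly one is the top left corner
of a shaded area with index `0` (a first one below another area): the letter `x (g t aᵖ)`. -/
def FirstBelow (x : BS → Letter A m) (g : BS) (p : ℕ) : Prop :=
  p < 2 ∧ ∀ k < 2, (∃ c, (x (g * gt * ga ^ k)).corner = some (c, 0)) ↔ k = p

/-- Rule 5: if a shaded area carries the letter `a` and its bottom is the pattern
`b1 b2 ⋯ b2 b3` of length `l` in position `g`, then the shaded areas immediately below it carry,
from left to right, the letters of `σ a` with their indices. The bound on `l` is a consequence of
Rule 3: a zone has at most `hi a + 2` letters in its first completely shaded row, and `n` letters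
in a row leave at most `2 n + 1` letters in the next row. -/
def SubstitutionRule (σ : A → List A) (h : ℕ) (hi : A → ℕ) (x : BS → Letter A m) : Prop :=
  ∀ g a i, x g = .b1 a i → ∃ l p q : ℕ, 2 ≤ l ∧ l ≤ 2 ^ h * (hi a + 3) ∧
    (∀ k, 1 ≤ k → k + 1 < l → x (g * ga ^ k) = .b2 a i) ∧
    x (g * ga ^ (l - 1)) = .b3 a i ∧
    FirstBelow x g p ∧ FirstBelow x (g * ga ^ l) q ∧
    (List.range' p (2 * l + q - p)).filterMap (fun k => (x (g * gt * ga ^ k)).corner)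
      = (σ a).zipIdx

end Rules

/-- `M = max |σ(a)|`. -/
def maxLen {A : Type*} [Fintype A] (σ : A → List A) : ℕ :=
  Finset.univ.sup fun a => (σ a).length

/-- `X_σ`, where the widths of the shaded zones with letter `a` range from `lo a` to `hi a` and
`h = ⌊log₂ lam⌋ - 1`. -/
def XSigma {A : Type*} [Fintype A] (σ : A → List A) (lam : ℝ) (lo hi : A → ℕ) :
    Set (BS → Letter A (maxLen σ)) :=
  {x | Matching x ∧ UniformKind x ∧ Heights (⌊Real.logb 2 lam⌋₊ - 1) x ∧ Widths lo hi x ∧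
    Synchronized x ∧ SubstitutionRule σ (⌊Real.logb 2 lam⌋₊ - 1) hi x}

end SigmaShift

/-! Two scales compete: one step along `t` doubles the number of positions in a row, while one
application of `σ` multiplies lengths by `λ`. When `log₂ λ` is irrational no relation `λ ^ J = 2 ^
q` with `q ≠ 0` holds, and a nontrivial period would produce one. By the normal form `tⁱ aʲ t⁻ᵏ`, it
is enough to exclude conjugates of `aʲ` with `j > 0` and elements with `k < i`, up to inversion
(`stronglyAperiodic_of`).

For `Y_σ`, the row at depth `k` below an `a`-tile spells `σᵏ a`. A horizontal translation
contradicts the existence of arbitrarily wide neighbouring tiles with different letters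
(`IsTiling.not_translation_invariant`). A contraction by `2 ^ q` carries two letter changes in one
row to pairs of changes in arbitrarily low rows under the same tile. Their distance, measured in the
scale of the new row, is the length of a word of bounded size, hence takes finitely many values. It
also equals `C * 2 ^ (-q n + k L)` with `L = log₂ λ`, which is impossible by the pigeonhole
principle (`IsTiling.not_contraction_invariant`, `pigeonhole_of_irrational`).

For `X_σ`, lengths are replaced by weights: the left end of each shaded area with letter `a` counts
for `v a`. Passing to the row below, the weight between two left ends is preserved under top and
middle letters, by edge matching, and multiplied by `λ` under bottom letters, by the substitution
rule (`rowWeight_below`). A period conjugate to `aʲ` persists with the same length in all higher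
rows, where its weight is `2 ^ N / λ ^ k` times the original one, although words of fixed length
have finitely many weights (`not_elliptic_period`). A period that changes the height makes the rows
repeat, so the weight per letter, multiplied by `λ ^ J / 2 ^ q` at each repetition, must stay
bounded above and below, whence `λ ^ J = 2 ^ q` (`not_hyperbolic_period`).

The SFT property holds because every rule inspects a bounded window (`IsLocal`, `IsLocal.isSFT`). -/

namespace SigmaShift

/-! ### Subshifts of finite type defined by local rules -/

section Local

variable {G B C D E : Type*}

/-- A function of the configuration that depends on finitely many coordinates only. -/
def IsLocal (f : (G → B) → C) : Prop :=
  ∃ S : Finset G, ∀ z z' : G → B, (∀ s ∈ S, z s = z' s) → f z = f z'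

theorem IsLocal.apply (s : G) : IsLocal fun z : G → B => z s :=
  ⟨{s}, fun _ _ h => h s (by simp)⟩

theorem IsLocal.const (c : C) : IsLocal fun _ : G → B => c :=
  ⟨∅, fun _ _ _ => rfl⟩

theorem IsLocal.map {f : (G → B) → C} (hf : IsLocal f) (F : C → D) :
    IsLocal fun z => F (f z) := by
  obtain ⟨S, hS⟩ := hf
  exact ⟨S, fun z z' h => congrArg F (hS z z' h)⟩

theorem IsLocal.map₂ {f : (G → B) → C} {g : (G → B) → D} (hf : IsLocal f) (hg : IsLocal g)
    (F : C → D → E) : IsLocal fun z => F (f z) (g z) := by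
  classical
  obtain ⟨S, hS⟩ := hf
  obtain ⟨T, hT⟩ := hg
  refine ⟨S ∪ T, fun z z' h => ?_⟩
  simp only [hS z z' fun s hs => h s (Finset.mem_union_left _ hs),
    hT z z' fun s hs => h s (Finset.mem_union_right _ hs)]

theorem IsLocal.and {p q : (G → B) → Prop} (hp : IsLocal p) (hq : IsLocal q) :
    IsLocal fun z => p z ∧ q z := hp.map₂ hq And

theorem IsLocal.or {p q : (G → B) → Prop} (hp : IsLocal p) (hq : IsLocal q) :
    IsLocal fun z => p z ∨ q z := hp.map₂ hq Or

theorem IsLocal.iff {p q : (G → B) → Prop} (hp : IsLocal p) (hq : IsLocal q) :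
    IsLocal fun z => (p z ↔ q z) := hp.map₂ hq Iff

theorem IsLocal.imp {p q : (G → B) → Prop} (hp : IsLocal p) (hq : IsLocal q) :
    IsLocal fun z => (p z → q z) := hp.map₂ hq fun p q => p → q

theorem IsLocal.not {p : (G → B) → Prop} (hp : IsLocal p) :
    IsLocal fun z => ¬ p z := hp.map Not

theorem IsLocal.pi {ι : Type*} [Finite ι] {f : ι → (G → B) → C} (hf : ∀ i, IsLocal (f i)) :
    IsLocal fun z i => f i z := by
  classical
  cases nonempty_fintype ι
  choose S hS using hf
  refine ⟨Finset.univ.biUnion S, fun z z' h => funext fun i => hS i z z' fun s hs => h s ?_⟩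
  exact Finset.mem_biUnion.2 ⟨i, Finset.mem_univ _, hs⟩

theorem IsLocal.forall {ι : Type*} [Finite ι] {p : ι → (G → B) → Prop}
    (hp : ∀ i, IsLocal (p i)) : IsLocal fun z => ∀ i, p i z :=
  (IsLocal.pi hp).map fun P => ∀ i, P i

theorem IsLocal.exists {ι : Type*} [Finite ι] {p : ι → (G → B) → Prop}
    (hp : ∀ i, IsLocal (p i)) : IsLocal fun z => ∃ i, p i z :=
  (IsLocal.pi hp).map fun P => ∃ i, P i

theorem IsLocal.congr {p q : (G → B) → Prop} (hp : IsLocal p) (h : ∀ z, p z ↔ q z) :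
    IsLocal q := by
  rwa [show q = p from funext fun z => propext (h z).symm]

/-- Explicit bounds on the integers in the rules on heights, widths and substitution reduce their
quantifiers to finite ones. -/
theorem IsLocal.exists_nat {p : ℕ → (G → B) → Prop} (N : ℕ) (hN : ∀ n z, p n z → n ≤ N)
    (hp : ∀ n, IsLocal (p n)) : IsLocal fun z => ∃ n, p n z := by
  refine (IsLocal.exists (ι := Fin (N + 1)) fun i => hp i).congr fun z => ?_
  exact ⟨fun ⟨i, hi⟩ => ⟨i, hi⟩, fun ⟨n, hn⟩ => ⟨⟨n, Nat.lt_succ_of_le (hN n z hn)⟩, hn⟩⟩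

theorem IsLocal.forall_nat {r : ℕ → Prop} {p : ℕ → (G → B) → Prop} (N : ℕ)
    (hN : ∀ n, r n → n ≤ N) (hp : ∀ n, IsLocal (p n)) : IsLocal fun z => ∀ n, r n → p n z := by
  refine (IsLocal.forall (ι := Fin (N + 1)) fun i => (IsLocal.const (r i)).imp (hp i)).congr
    fun z => ?_
  exact ⟨fun h n hn => h ⟨n, Nat.lt_succ_of_le (hN n hn)⟩ hn, fun h i => h i⟩

theorem IsLocal.filterMap {ι : Type*} {f : ι → (G → B) → Option C} (hf : ∀ i, IsLocal (f i))
    (l : List ι) : IsLocal fun z => l.filterMap fun i => f i z := by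
  induction l with
  | nil => exact IsLocal.const _
  | cons i l ih =>
    simp only [List.filterMap_cons]
    exact (hf i).map₂ ih fun o r => match o with | none => r | some b => b :: r

variable [Group G]

/-- The forbidden patterns are those on `S` none of whose extensions satisfies `p`. There are
finitely many since `B` is finite, and one extension decides for all since `p` only sees `S`. -/
theorem IsLocal.isSFT [Finite B] {p : (G → B) → Prop} (hp : IsLocal p) :
    IsSFT {x : G → B | ∀ g, p fun h => x (g * h)} := by
  obtain ⟨S, hS⟩ := hp
  refine ⟨Sigma.mk S '' {q | ∀ z : G → B, (∀ s : S, q s = z s) → ¬ p z},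
    (Set.toFinite _).image _, Set.ext fun x => ?_⟩
  simp only [Set.mem_ofPred_eq, Set.forall_mem_image, Appears, shift, not_exists]
  refine ⟨fun hx q hq g hg => ?_, fun hx g => ?_⟩
  · have h := hx g⁻¹
    exact hq _ hg h
  · by_contra hg
    refine hx (x := fun s => x (g * s)) (fun z hz hpz => hg ?_) g⁻¹ fun s => by simp
    rwa [hS _ z fun s hs => hz ⟨s, hs⟩]

theorem IsSFT.inter {X Y : Set (G → B)} (hX : IsSFT X) (hY : IsSFT Y) : IsSFT (X ∩ Y) := by
  obtain ⟨F, hF, rfl⟩ := hX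
  obtain ⟨F', hF', rfl⟩ := hY
  refine ⟨F ∪ F', hF.union hF', Set.ext fun x => ?_⟩
  simp only [Set.mem_inter_iff, Set.mem_ofPred_eq, Set.mem_union]
  exact ⟨fun h p hp => hp.elim (h.1 p) (h.2 p), fun h => ⟨fun p hp => h p (.inl hp),
    fun p hp => h p (.inr hp)⟩⟩

end Local

/-! ### `X_σ` is a subshift of finite type -/

section RulesLocal

variable {A : Type*} {m : ℕ}

theorem isLocal_firstBelow (g : BS) (p : ℕ) :
    IsLocal fun z : BS → Letter A m => FirstBelow z g p :=
  (IsLocal.const _).and (IsLocal.forall_nat 2 (fun _ hk => hk.le) fun _ =>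
    ((IsLocal.apply _).map fun l : Letter A m => ∃ c, l.corner = some (c, 0)).iff (IsLocal.const _))

instance [Finite A] : Finite (Letter A m) := by
  -- A letter is coded by its constructor and two pairs; letters with a single pair repeat it.
  let f : Letter A m → Fin 12 × A × Option (Fin m) × A × Option (Fin m) := fun
    | .t1 b j a i => (0, b, some j, a, some i)
    | .t2 a i => (1, a, some i, a, some i)
    | .t3 a i => (2, a, some i, a, some i)
    | .t4 a i => (3, a, some i, a, some i)
    | .m1 a i => (4, a, some i, a, some i)
    | .m2 b j a i => (5, b, some j, a, some i)
    | .m3 a i => (6, a, some i, a, some i)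
    | .m4 a i => (7, a, some i, a, some i)
    | .m5 a i => (8, a, some i, a, some i)
    | .b1 a i => (9, a, some i, a, some i)
    | .b2 a i => (10, a, some i, a, some i)
    | .b3 a i => (11, a, some i, a, some i)
  refine Finite.of_injective f fun p q h => ?_
  cases p <;> cases q <;> simp_all [f]

variable [Finite A]

theorem isSFT_matching : IsSFT {x : BS → Letter A m | Matching x} := by
  have h (F : Letter A m → Letter A m → Prop) (s s' : BS) :
      IsLocal fun z : BS → Letter A m => F (z s) (z s') :=
    (IsLocal.apply s).map₂ (IsLocal.apply s') F
  have := ((h (fun l l' => l.rightEdge = l'.leftEdge) 1 ga).and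
    ((h (fun l l' => l.botLeft = l'.topEdge) 1 gt).and
    (h (fun l l' => l.botRight = l'.topEdge) 1 (gt * ga)))).isSFT
  simpa only [mul_one, mul_assoc, Matching] using this

theorem isSFT_uniformKind : IsSFT {x : BS → Letter A m | UniformKind x} := by
  have := ((IsLocal.apply (B := Letter A m) (ga : BS)).map₂ (IsLocal.apply 1)
    fun l l' : Letter A m => l.kind = l'.kind).isSFT
  simpa only [mul_one, UniformKind] using this

theorem isSFT_heights (h : ℕ) : IsSFT {x : BS → Letter A m | Heights h x} := by
  have hk (s : BS) (k : Kind) : IsLocal fun z : BS → Letter A m => (z s).kind = k :=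
    (IsLocal.apply s).map fun l : Letter A m => l.kind = k
  have h1 : IsLocal fun z : BS → Letter A m => (z 1).kind = .top →
      ∃ n, (n = h ∨ n + 1 = h) ∧ (∀ k, 1 ≤ k → k ≤ n → (z (gt ^ k)).kind = .mid) ∧
        (z (gt ^ (n + 1))).kind = .bot := by
    refine (hk _ _).imp (IsLocal.exists_nat h (fun n z hn => by omega) fun n =>
      (IsLocal.const _).and (IsLocal.and ?_ (hk _ _)))
    simp only [← and_imp]
    exact IsLocal.forall_nat n (fun k hk => hk.2) fun k => hk _ _
  have h2 : IsLocal fun z : BS → Letter A m => ∃ k ≤ h + 1, (z (gt ^ k)).kind = .top :=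
    IsLocal.exists_nat (h + 1) (fun n z hn => hn.1) fun n => (IsLocal.const _).and (hk _ _)
  have := h1.isSFT.inter h2.isSFT
  simpa only [mul_one, Heights, Set.ofPred_and] using this

theorem isSFT_widths (lo hi : A → ℕ) : IsSFT {x : BS → Letter A m | Widths lo hi x} := by
  have hl (s : BS) (k : Letter A m) : IsLocal fun z : BS → Letter A m => z s = k :=
    (IsLocal.apply s).map fun l => l = k
  have h1 : IsLocal fun z : BS → Letter A m =>
      ((z gt⁻¹).kind = .top ∨ (z (ga⁻¹ * gt⁻¹)).kind = .top) → ∀ a i,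
    ((z 1 = .m1 a i ∨ ∃ b j, z 1 = .m2 b j a i) →
      ∃ r, lo a ≤ r ∧ r ≤ hi a ∧ (∀ k, 1 ≤ k → k ≤ r → z (ga ^ k) = .m3 a i) ∧
        (z (ga ^ (r + 1)) = .m4 a i ∨ z (ga ^ (r + 1)) = .m5 a i)) ∧
    ¬ ∀ k ≤ hi a, z (ga ^ k) = .m3 a i := by
    refine IsLocal.imp (((IsLocal.apply _).map fun l : Letter A m => l.kind = .top).or
      ((IsLocal.apply _).map fun l : Letter A m => l.kind = .top)) (IsLocal.forall fun a => IsLocal.forall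
        fun i => IsLocal.and (IsLocal.imp ((hl _ _).or (IsLocal.exists fun b =>
          IsLocal.exists fun j => hl _ _)) ?_) (IsLocal.not ?_))
    · refine IsLocal.exists_nat (hi a) (fun r z hr => hr.2.1) fun r =>
        (IsLocal.const _).and ((IsLocal.const _).and (IsLocal.and ?_ ((hl _ _).or (hl _ _))))
      simp only [← and_imp]
      exact IsLocal.forall_nat r (fun k hk => hk.2) fun k => hl _ _
    · exact IsLocal.forall_nat (hi a) (fun k hk => hk) fun k => hl _ _
  have := h1.isSFT
  simpa only [mul_one, Widths, InTopRow, mul_assoc] using this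

theorem isSFT_synchronized : IsSFT {x : BS → Letter A m | Synchronized x} := by
  have hl (s : BS) (k : Letter A m) : IsLocal fun z : BS → Letter A m => z s = k :=
    (IsLocal.apply s).map fun l => l = k
  have h1 : IsLocal fun z : BS → Letter A m => ∀ b j a i, z 1 = .t1 b j a i →
      z (gt * (ga * gt⁻¹)) = .t2 a i ∧ z (gt * (ga⁻¹ * gt⁻¹)) = .t4 b j :=
    IsLocal.forall fun b => IsLocal.forall fun j => IsLocal.forall fun a => IsLocal.forall fun i =>
      (hl _ _).imp ((hl _ _).and (hl _ _))
  have h2 (β : A → Fin m → Letter A m) : IsLocal fun z : BS → Letter A m => ∀ a i, z 1 = β a i →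
      z (gt * (ga * gt⁻¹)) = β a i ∨ z (gt * (ga⁻¹ * gt⁻¹)) = β a i :=
    IsLocal.forall fun a => IsLocal.forall fun i => (hl _ _).imp ((hl _ _).or (hl _ _))
  have h3 : IsLocal fun z : BS → Letter A m => ∀ a i, z 1 = .m1 a i ↔
      ∃ b j, z (gt * (ga⁻¹ * gt⁻¹)) = .m2 b j a i :=
    IsLocal.forall fun a => IsLocal.forall fun i => (hl _ _).iff
      (IsLocal.exists fun b => IsLocal.exists fun j => hl _ _)
  have := h1.isSFT.inter ((h2 .b1).isSFT.inter ((h2 .b3).isSFT.inter h3.isSFT))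
  simpa only [mul_one, Synchronized, mul_assoc, Set.ofPred_and] using this

theorem isSFT_substitutionRule (σ : A → List A) (h : ℕ) (hi : A → ℕ) :
    IsSFT {x : BS → Letter A m | SubstitutionRule σ h hi x} := by
  have hl (s : BS) (k : Letter A m) : IsLocal fun z : BS → Letter A m => z s = k :=
    (IsLocal.apply s).map fun l => l = k
  have h1 : IsLocal fun z : BS → Letter A m => ∀ a i, z 1 = .b1 a i →
      ∃ l p q : ℕ, 2 ≤ l ∧ l ≤ 2 ^ h * (hi a + 3) ∧
      (∀ k, 1 ≤ k → k + 1 < l → z (ga ^ k) = .b2 a i) ∧ z (ga ^ (l - 1)) = .b3 a i ∧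
      FirstBelow z 1 p ∧ FirstBelow z (ga ^ l) q ∧
      (List.range' p (2 * l + q - p)).filterMap (fun k => (z (gt * ga ^ k)).corner)
        = (σ a).zipIdx := by
    refine IsLocal.forall fun a => IsLocal.forall fun i => (hl _ _).imp ?_
    refine IsLocal.exists_nat (2 ^ h * (hi a + 3))
      (fun l z => by rintro ⟨p, q, -, hl, -⟩; exact hl) fun l => ?_
    refine IsLocal.exists_nat 2 (fun p z => by rintro ⟨q, -, -, -, -, hp, -⟩; exact hp.1.le)
      fun p => ?_
    refine IsLocal.exists_nat 2 (fun q z => by rintro ⟨-, -, -, -, -, hq, -⟩; exact hq.1.le)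
      fun q => (IsLocal.const _).and ((IsLocal.const _).and (IsLocal.and ?_ ((hl _ _).and
        ((isLocal_firstBelow _ _).and ((isLocal_firstBelow _ _).and ?_)))))
    · simp only [← and_imp]
      exact IsLocal.forall_nat l (fun k hk => by omega) fun k => hl _ _
    · exact (IsLocal.filterMap (fun k => (IsLocal.apply _).map Letter.corner) _).map
        fun r => r = (σ a).zipIdx
  have := h1.isSFT
  simpa only [mul_one, SubstitutionRule, FirstBelow, mul_assoc, one_mul] using this

end RulesLocal

theorem isSFT_XSigma {A : Type*} [Fintype A] (σ : A → List A) (lam : ℝ) (lo hi : A → ℕ) :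
    IsSFT (XSigma σ lam lo hi) :=
  isSFT_matching.inter (isSFT_uniformKind.inter ((isSFT_heights _).inter
    ((isSFT_widths lo hi).inter (isSFT_synchronized.inter (isSFT_substitutionRule σ _ hi)))))

/-! ### Normal forms in `BS(1,2)` -/

theorem ga_mul_gt : ga * gt = gt * ga ^ 2 := by
  have h : PresentedGroup.mk rels ((FreeGroup.of Gen.t)⁻¹ * FreeGroup.of Gen.a *
      FreeGroup.of Gen.t * (FreeGroup.of Gen.a ^ 2)⁻¹) = 1 :=
    PresentedGroup.one_of_mem (by simp [rels])
  have h' : gt⁻¹ * ga * gt * (ga ^ 2)⁻¹ = 1 := h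
  rw [mul_inv_eq_one, mul_assoc, inv_mul_eq_iff_eq_mul] at h'
  exact h'

theorem ga_zpow_mul_gt (j : ℤ) : ga ^ j * gt = gt * ga ^ (2 * j) := by
  have h : SemiconjBy gt (ga ^ 2) ga := ga_mul_gt.symm
  have := h.zpow_right j
  rw [zpow_mul]
  exact this.symm

theorem ga_zpow_mul_gt_pow (j : ℤ) (n : ℕ) : ga ^ j * gt ^ n = gt ^ n * ga ^ (2 ^ n * j) := by
  induction n with
  | zero => simp
  | succ n ih => rw [pow_succ, ← mul_assoc, ih, mul_assoc, ga_zpow_mul_gt, ← mul_assoc,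
      ← mul_assoc, pow_succ']

theorem gt_inv_mul_ga_zpow (j : ℤ) : gt⁻¹ * ga ^ j = ga ^ (2 * j) * gt⁻¹ := by
  rw [inv_mul_eq_iff_eq_mul, ← mul_assoc, ← ga_zpow_mul_gt, mul_inv_cancel_right]

theorem exists_normalForm (g : BS) : ∃ (i k : ℕ) (j : ℤ), g = gt ^ i * ga ^ j * (gt ^ k)⁻¹ := by
  have hg : g ∈ Subgroup.closure (Set.range (PresentedGroup.of (rels := rels))) := by
    rw [PresentedGroup.closure_range_of]; trivial
  have hga (s : ℤ) (i k : ℕ) (j : ℤ) : ga ^ s * (gt ^ i * ga ^ j * (gt ^ k)⁻¹) =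
      gt ^ i * ga ^ (2 ^ i * s + j) * (gt ^ k)⁻¹ := by
    rw [← mul_assoc, ← mul_assoc, ga_zpow_mul_gt_pow, zpow_add, mul_assoc (gt ^ i)]
  induction hg using Subgroup.closure_induction_left with
  | one => exact ⟨0, 0, 0, by simp⟩
  | mul_left y hy h _ ih =>
    obtain ⟨i, k, j, rfl⟩ := ih
    obtain ⟨_ | _, rfl⟩ := hy
    · exact ⟨i, k, _, by rw [← hga 1 i k j, zpow_one]; rfl⟩
    · exact ⟨i + 1, k, j, by rw [pow_succ']; simp only [mul_assoc]; rfl⟩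
  | inv_mul_cancel y hy h _ ih =>
    obtain ⟨i, k, j, rfl⟩ := ih
    obtain ⟨_ | _, rfl⟩ := hy
    · exact ⟨i, k, _, by rw [← hga (-1) i k j, zpow_neg_one]; rfl⟩
    · cases i with
      | succ i => exact ⟨i, k, j, by
          rw [pow_succ', inv_mul_eq_iff_eq_mul]; simp only [mul_assoc]; rfl⟩
      -- With no `t` to cancel, `t⁻¹` is pushed to the right through `aʲ`, which doubles `j`.
      | zero =>
        refine ⟨0, k + 1, 2 * j, ?_⟩
        have := gt_inv_mul_ga_zpow j
        simp only [pow_zero, one_mul, pow_succ, mul_inv_rev, ← mul_assoc]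
        rw [← this]; rfl

/-! ### Irrationality -/

theorem eq_zero_of_irrational {L : ℝ} (hL : Irrational L) {z w : ℤ} (h : (z : ℝ) * L = w) :
    w = 0 := by
  by_contra hw
  have hz : z ≠ 0 := by
    rintro rfl
    rw [Int.cast_zero, zero_mul] at h
    exact hw (Int.cast_eq_zero.1 h.symm)
  exact hL.intCast_mul hz ⟨w, by rw [h, Rat.cast_intCast]⟩

/-- Two indices with the same value have equal exponents, that is, an integer multiple of `L` equals
the nonzero integer `q * (n - n')`. -/
theorem pigeonhole_of_irrational {L : ℝ} (hL : Irrational L) {q : ℤ} (hq : q ≠ 0) {C : ℝ}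
    (hC : 0 < C) {F : Set ℝ} (hF : F.Finite)
    (h : ∀ n : ℕ, ∃ k : ℤ, C * (2 : ℝ) ^ ((q : ℝ) * n + k * L) ∈ F) : False := by
  choose k hk using h
  have := hF.to_subtype
  obtain ⟨n, n', hne, he⟩ := Finite.exists_ne_map_eq_of_infinite fun n => (⟨_, hk n⟩ : F)
  have h1 := mul_left_cancel₀ hC.ne' (Subtype.ext_iff.1 he)
  have h2 := (Real.rpow_right_inj (by norm_num) (by norm_num)).1 h1
  have h3 : ((k n' - k n : ℤ) : ℝ) * L = ((q * (n - n') : ℤ) : ℝ) := by push_cast; linarith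
  rcases mul_eq_zero.1 (eq_zero_of_irrational hL h3) with h | h
  · exact hq h
  · omega

/-! ### Stabilizers -/

/-- An element and its inverse stabilize the same configurations, so the signs of `i - k` and `j`
can be chosen. -/
theorem stronglyAperiodic_of {B : Type*} {X : Set (BS → B)}
    (h0 : ∀ x ∈ X, ∀ (i : ℕ) (j : ℤ), 0 < j → ¬ ∀ u, x (gt ^ i * ga ^ j * (gt ^ i)⁻¹ * u) = x u)
    (h1 : ∀ x ∈ X, ∀ (i k : ℕ) (j : ℤ), k < i →
      ¬ ∀ u, x (gt ^ i * ga ^ j * (gt ^ k)⁻¹ * u) = x u) :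
    StronglyAperiodic X := by
  intro x hx
  refine Set.eq_singleton_iff_unique_mem.2 ⟨funext fun u => by simp [shift], fun g hg => ?_⟩
  have hinv : ∀ u, x (g⁻¹ * u) = x u := fun u => congrFun hg u
  have hfwd : ∀ u, x (g * u) = x u := fun u => by rw [← hinv, inv_mul_cancel_left]
  obtain ⟨i, k, j, rfl⟩ := exists_normalForm g
  have he : (gt ^ i * ga ^ j * (gt ^ k)⁻¹)⁻¹ = gt ^ k * ga ^ (-j) * (gt ^ i)⁻¹ := by group
  rw [he] at hinv
  rcases lt_trichotomy k i with hki | rfl | hki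
  · exact (h1 x hx i k j hki hfwd).elim
  · rcases lt_trichotomy j 0 with hj | rfl | hj
    · exact (h0 x hx k (-j) (by omega) hinv).elim
    · simp
    · exact (h0 x hx k j hj hfwd).elim
  · exact (h1 x hx k i (-j) hki hinv).elim

/-! ### Iterated substitutions -/

section Words

variable {A : Type*}

/-- The word `σᵏ a`. -/
def iterSubst (σ : A → List A) : ℕ → A → List A
  | 0, a => [a]
  | k + 1, a => (iterSubst σ k a).flatMap σ

theorem iterSubst_add (σ : A → List A) (m k : ℕ) (a : A) :
    iterSubst σ (m + k) a = (iterSubst σ m a).flatMap (iterSubst σ k) := by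
  induction k with
  | zero => simp [iterSubst]
  | succ k ih => rw [← add_assoc, iterSubst, ih, List.flatMap_assoc]; rfl

theorem exists_of_flatMap_eq_append_cons {σ : A → List A} {l u u' : List A} {b : A}
    (h : l.flatMap σ = u ++ b :: u') :
    ∃ p c q r s, l = p ++ c :: q ∧ σ c = r ++ b :: s ∧ u = p.flatMap σ ++ r := by
  induction l generalizing u with
  | nil => simp at h
  | cons c l ih =>
    rw [List.flatMap_cons, List.append_eq_append_iff] at h
    rcases h with ⟨s, rfl, h⟩ | ⟨s, h, h'⟩
    · obtain ⟨p, d, q, r, s, rfl, hd, rfl⟩ := ih h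
      exact ⟨c :: p, d, q, r, s, rfl, hd, by simp⟩
    · cases s with
      | nil =>
        obtain ⟨p, d, q, r, s, rfl, hd, h0⟩ := ih (u := []) h'.symm
        refine ⟨c :: p, d, q, r, s, rfl, hd, ?_⟩
        rw [List.flatMap_cons, h, List.append_nil, List.append_assoc, ← h0, List.append_nil]
      | cons e s =>
        obtain ⟨rfl, rfl⟩ := List.cons.inj h'
        exact ⟨[], c, l, u, s, rfl, h, by simp⟩

theorem exists_adjacent_ne {l : List A} {b c : A} (hb : b ∈ l) (hc : c ∈ l) (hbc : b ≠ c) :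
    ∃ u d e u', l = u ++ d :: e :: u' ∧ d ≠ e := by
  by_contra! h
  have key : l.IsChain (· = ·) := by
    rw [List.isChain_iff_forall_rel_of_append_cons_cons]
    intro d e u u' hl
    exact h u d e u' hl
  rw [List.isChain_iff_pairwise] at key
  exact hbc (List.Pairwise.forall_of_forall (fun _ _ => rfl) key hb hc)

theorem exists_prefix_sum_le {v : A → ℝ} {l : List A} {t : ℝ} (h0 : 0 ≤ t)
    (ht : t < (l.map v).sum) :
    ∃ u e u', l = u ++ e :: u' ∧ (u.map v).sum ≤ t ∧ t < (u.map v).sum + v e := by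
  induction l generalizing t with
  | nil => simp at ht; linarith
  | cons a l ih =>
    by_cases hta : t < v a
    · exact ⟨[], a, l, rfl, by simpa using h0, by simpa using hta⟩
    · obtain ⟨u, e, u', rfl, h1, h2⟩ := ih (t := t - v a) (by linarith)
        (by simp at ht ⊢; linarith)
      exact ⟨a :: u, e, u', rfl, by simp; linarith, by simp; linarith⟩

theorem sum_map_flatMap {σ : A → List A} {v : A → ℝ} {lam : ℝ}
    (h : ∀ a, ((σ a).map v).sum = lam * v a) (l : List A) :
    ((l.flatMap σ).map v).sum = lam * (l.map v).sum := by
  induction l with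
  | nil => simp
  | cons a l ih => simp [ih, h, mul_add]

theorem sum_map_iterSubst {σ : A → List A} {v : A → ℝ} {lam : ℝ}
    (h : ∀ a, ((σ a).map v).sum = lam * v a) (k : ℕ) (a : A) :
    ((iterSubst σ k a).map v).sum = lam ^ k * v a := by
  induction k with
  | zero => simp [iterSubst]
  | succ k ih => rw [iterSubst, sum_map_flatMap h, ih]; ring

theorem length_le_sum_map {v : A → ℝ} (hv : ∀ a, 1 ≤ v a) (l : List A) :
    (l.length : ℝ) ≤ (l.map v).sum := by
  induction l with
  | nil => simp
  | cons a l ih => simp; linarith [hv a]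

variable [Fintype A] [DecidableEq A]

theorem IsExpanding.sum_map {σ : A → List A} {v : A → ℝ} {lam : ℝ} (hv : IsExpanding σ lam v)
    (a : A) : ((σ a).map v).sum = lam * v a := by
  have h := congrFun hv.2.2 a
  simp only [Matrix.mulVec, dotProduct, Matrix.map_apply, incidence, Matrix.of_apply,
    Pi.smul_apply, smul_eq_mul] at h
  rw [← h, Finset.sum_list_map_count]
  simp only [nsmul_eq_mul]
  refine Finset.sum_subset (Finset.subset_univ _) fun b _ hb => ?_
  rw [List.count_eq_zero_of_not_mem (by simpa using hb)]
  simp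

theorem mem_iterSubst {σ : A → List A} {k : ℕ} {a b : A} (h : 0 < (incidence σ ^ k) a b) :
    b ∈ iterSubst σ k a := by
  induction k generalizing b with
  | zero =>
    rw [pow_zero, Matrix.one_apply] at h
    split_ifs at h with hab
    · simp [iterSubst, hab]
    · simp at h
  | succ k ih =>
    rw [pow_succ, Matrix.mul_apply] at h
    obtain ⟨c, -, hc⟩ := Finset.exists_ne_zero_of_sum_ne_zero h.ne'
    have h1 := Nat.pos_of_ne_zero (left_ne_zero_of_mul hc)
    have h2 := Nat.pos_of_ne_zero (right_ne_zero_of_mul hc)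
    exact List.mem_flatMap.2 ⟨c, ih h1, List.count_pos_iff.1 h2⟩

theorem IsPrimitive.exists_adjacent_ne [Nontrivial A] {σ : A → List A} (hσ : IsPrimitive σ) :
    ∃ k, ∀ a, ∃ u d e u', iterSubst σ k a = u ++ d :: e :: u' ∧ d ≠ e := by
  obtain ⟨k, hk⟩ := hσ
  obtain ⟨b, c, hbc⟩ := exists_pair_ne A
  exact ⟨k, fun a => SigmaShift.exists_adjacent_ne (mem_iterSubst (hk a b))
    (mem_iterSubst (hk a c)) hbc⟩

/-- Each of two consecutive letters of `σᵏ a` expands under `σᵏ` to a word containing an adjacent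
pair of different letters. -/
theorem IsPrimitive.exists_two_adjacent_ne [Nontrivial A] {σ : A → List A} (hσ : IsPrimitive σ) :
    ∃ k, ∀ a, ∃ u d e w d' e' u',
      iterSubst σ k a = (u ++ d :: e :: w) ++ d' :: e' :: u' ∧ d ≠ e ∧ d' ≠ e' := by
  obtain ⟨k, hk⟩ := hσ.exists_adjacent_ne
  refine ⟨k + k, fun a => ?_⟩
  obtain ⟨u, d, e, u', h, -⟩ := hk a
  obtain ⟨p, f, f', q, hd, hf⟩ := hk d
  obtain ⟨p', g, g', q', he, hg⟩ := hk e
  refine ⟨u.flatMap (iterSubst σ k) ++ p, f, f', q ++ p', g, g',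
    q' ++ u'.flatMap (iterSubst σ k), ?_, hf, hg⟩
  simp [iterSubst_add, h, hd, he]

end Words

/-! ### The rows below a tile -/

section Tilings

variable {A : Type*} {σ : A → List A} {lam : ℝ} {v : A → ℝ}
  {T : Set (A × ℝ × ℝ)} {τ : ℝ × ℝ → A}

theorem two_rpow_sub_logb (hlam : 1 < lam) (y : ℝ) :
    (2 : ℝ) ^ (y - Real.logb 2 lam) = 2 ^ y / lam := by
  rw [Real.rpow_sub two_pos, Real.rpow_logb two_pos (by norm_num) (by linarith)]

theorem two_rpow_sub_mul_logb (hlam : 1 < lam) (y : ℝ) (k : ℕ) :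
    (2 : ℝ) ^ (y - k * Real.logb 2 lam) = 2 ^ y / lam ^ k := by
  rw [Real.rpow_sub two_pos, mul_comm, Real.rpow_mul_natCast two_pos.le,
    Real.rpow_logb two_pos (by norm_num) (by linarith)]

/-- At depth `k` the scale is `2 ^ y / λ ^ k`, and each application of `σ` multiplies word lengths
by `λ`, so prefixes keep their left ends. -/
theorem IsTiling.iterSubst_mem (hT : IsTiling σ lam v T) (hlam : 1 < lam)
    (hv : ∀ a, ((σ a).map v).sum = lam * v a) {a : A} {x y : ℝ} (ha : (a, x, y) ∈ T) (k : ℕ)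
    {u u' : List A} {b : A} (h : iterSubst σ k a = u ++ b :: u') :
    (b, x + (u.map v).sum * 2 ^ (y - k * Real.logb 2 lam), y - k * Real.logb 2 lam) ∈ T := by
  induction k generalizing u b u' with
  | zero =>
    rw [iterSubst, eq_comm, List.append_eq_singleton_iff] at h
    rcases h with ⟨rfl, h⟩ | ⟨rfl, h⟩
    · obtain ⟨rfl, -⟩ := List.cons.inj h
      simpa using ha
    · simp at h
  | succ k ih =>
    obtain ⟨p, c, q, r, s, hw, hc, rfl⟩ := exists_of_flatMap_eq_append_cons h
    have := hT.subst _ _ _ (ih hw) r.length (by rw [hc]; simp)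
    have e1 : (σ c)[r.length]'(by rw [hc]; simp) = b := by simp [hc]
    have e2 : (σ c).take r.length = r := by simp [hc]
    have e3 : y - k * Real.logb 2 lam - Real.logb 2 lam = y - (k + 1 : ℕ) * Real.logb 2 lam := by
      push_cast; ring
    rw [e1, e2, e3] at this
    convert this using 3
    rw [← e3, two_rpow_sub_logb hlam, List.map_append, List.sum_append, sum_map_flatMap hv]
    field_simp
    ring

/-- `τ` is free only on tile boundaries: another tile containing the point has it in the closure of
its own interior, so the two interiors would meet. -/
theorem IsTiling.eq_of_mem_interior (hT : IsTiling σ lam v T)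
    (hlam : 1 < lam) (hv : ∀ a, 0 < v a)
    (hτ : ∀ z, ∃ p ∈ T, z ∈ tile lam v p ∧ τ z = p.1) {b : A} {x y r n : ℝ} (hb : (b, x, y) ∈ T)
    (hr : r ∈ Set.Ioo x (x + v b * 2 ^ y)) (hn : n ∈ Set.Ioo (y - Real.logb 2 lam) y) :
    τ (r, n) = b := by
  obtain ⟨p, hp, hz, hpz⟩ := hτ (r, n)
  by_cases hpb : p = (b, x, y)
  · rw [hpz, hpb]
  exfalso
  have hint (q : A × ℝ × ℝ) : interior (tile lam v q) =
      Set.Ioo q.2.1 (q.2.1 + v q.1 * 2 ^ q.2.2) ×ˢ Set.Ioo (q.2.2 - Real.logb 2 lam) q.2.2 := by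
    rw [tile, interior_prod_eq, interior_Icc, interior_Icc]
  have hL : 0 < Real.logb 2 lam := Real.logb_pos (by norm_num) hlam
  have hcl : (r, n) ∈ closure (interior (tile lam v p)) := by
    have h1 : 0 < v p.1 * (2 : ℝ) ^ p.2.2 := mul_pos (hv _) (Real.rpow_pos_of_pos two_pos _)
    rw [hint, closure_prod_eq, closure_Ioo (by linarith), closure_Ioo (by linarith)]
    exact hz
  have hin : (r, n) ∈ interior (tile lam v (b, x, y)) := by
    rw [hint]; exact ⟨hr, hn⟩
  obtain ⟨z, hz1, hz2⟩ := mem_closure_iff.1 hcl _ isOpen_interior hin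
  exact Set.disjoint_left.1 (hT.disjoint hp hb hpb) hz2 hz1

/-- Dyadic rational numbers. -/
def IsDyadic (r : ℝ) : Prop := ∃ (i : ℕ) (j : ℤ), r = j / 2 ^ i

theorem exists_isDyadic_between {α β : ℝ} (h : α < β) : ∃ r, IsDyadic r ∧ α < r ∧ r < β := by
  obtain ⟨i, hi⟩ := pow_unbounded_of_one_lt (1 / (β - α)) one_lt_two
  have h2 : (0 : ℝ) < 2 ^ i := by positivity
  rw [div_lt_iff₀ (by linarith)] at hi
  refine ⟨_, ⟨i, ⌊α * 2 ^ i⌋ + 1, rfl⟩, ?_, ?_⟩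
  · rw [lt_div_iff₀ h2]; push_cast; exact Int.lt_floor_add_one _
  · rw [div_lt_iff₀ h2]; push_cast; linarith [Int.floor_le (α * 2 ^ i)]

theorem IsDyadic.affine {r : ℝ} (hr : IsDyadic r) (i q : ℕ) (j : ℤ) :
    IsDyadic ((r - j / 2 ^ i) * 2 ^ q) := by
  obtain ⟨i', j', rfl⟩ := hr
  refine ⟨i' + i, (j' * 2 ^ i - j * 2 ^ i') * 2 ^ q, ?_⟩
  push_cast
  field_simp
  ring

/-- On the dyadic points of height `n`, the map `τ` has different letters on the two sides
of `β`. -/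
def IsChange (τ : ℝ × ℝ → A) (n β : ℝ) : Prop :=
  ∃ b c, b ≠ c ∧ ∃ δ > 0, (∀ r, IsDyadic r → β - δ < r → r < β → τ (r, n) = b) ∧
    ∀ r, IsDyadic r → β < r → r < β + δ → τ (r, n) = c

variable (hT : IsTiling σ lam v T) (hlam : 1 < lam) (hv0 : ∀ a, 0 < v a)
  (hv : ∀ a, ((σ a).map v).sum = lam * v a)
  (hτ : ∀ z, ∃ p ∈ T, z ∈ tile lam v p ∧ τ z = p.1)
include hT hlam hv0 hv hτ

theorem IsTiling.eq_of_iterSubst {a : A} {x y : ℝ} (ha : (a, x, y) ∈ T) (k : ℕ)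
    {u u' : List A} {b : A} (h : iterSubst σ k a = u ++ b :: u') {r n : ℝ}
    (hr : x + (u.map v).sum * 2 ^ (y - k * Real.logb 2 lam) < r)
    (hr' : r < x + ((u.map v).sum + v b) * 2 ^ (y - k * Real.logb 2 lam))
    (hn : y - (k + 1) * Real.logb 2 lam < n) (hn' : n < y - k * Real.logb 2 lam) :
    τ (r, n) = b :=
  hT.eq_of_mem_interior hlam hv0 hτ (hT.iterSubst_mem hlam hv ha k h) ⟨hr, by linarith⟩
    ⟨by linarith, hn'⟩

theorem IsTiling.isChange {a : A} {x y : ℝ} (ha : (a, x, y) ∈ T) (k : ℕ)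
    {u u' : List A} {b c : A} (h : iterSubst σ k a = u ++ b :: c :: u') (hbc : b ≠ c) {n : ℝ}
    (hn : y - (k + 1) * Real.logb 2 lam < n) (hn' : n < y - k * Real.logb 2 lam) :
    IsChange τ n (x + ((u.map v).sum + v b) * 2 ^ (y - k * Real.logb 2 lam)) := by
  have hs : (0 : ℝ) < 2 ^ (y - k * Real.logb 2 lam) := Real.rpow_pos_of_pos two_pos _
  have hb := mul_pos (hv0 b) hs
  have hc := mul_pos (hv0 c) hs
  refine ⟨b, c, hbc, _, lt_min hb hc, fun r _ h1 h2 => ?_, fun r _ h1 h2 => ?_⟩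
  · refine hT.eq_of_iterSubst hlam hv0 hv hτ ha k h ?_ h2 hn hn'
    linarith [min_le_left (v b * (2 : ℝ) ^ (y - k * Real.logb 2 lam))
      (v c * 2 ^ (y - k * Real.logb 2 lam))]
  · refine hT.eq_of_iterSubst hlam hv0 hv hτ ha k (u := u ++ [b]) (u' := u') (b := c)
      (by simpa using h) (by simpa using h1) ?_ hn hn'
    simp only [List.map_append, List.sum_append, List.map_cons, List.map_nil, List.sum_cons,
      List.sum_nil]
    linarith [min_le_right (v b * (2 : ℝ) ^ (y - k * Real.logb 2 lam))
      (v c * 2 ^ (y - k * Real.logb 2 lam))]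

/-- Otherwise the point is strictly inside the top edge of some tile of the row, where the letter is
the same on both sides. Dyadic points close enough to it on each side witness the contradiction. -/
theorem IsTiling.exists_prefix_of_isChange {a : A} {x y : ℝ} (ha : (a, x, y) ∈ T) (k : ℕ) {n β : ℝ}
    (hn : y - (k + 1) * Real.logb 2 lam < n) (hn' : n < y - k * Real.logb 2 lam)
    (hβ : IsChange τ n β) (hx : x ≤ β) (hx' : β < x + v a * 2 ^ y) :
    ∃ u, u <+: iterSubst σ k a ∧ β = x + (u.map v).sum * 2 ^ (y - k * Real.logb 2 lam) := by
  have hs : (0 : ℝ) < 2 ^ (y - k * Real.logb 2 lam) := Real.rpow_pos_of_pos two_pos _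
  obtain ⟨u, e, u', hw, h1, h2⟩ := exists_prefix_sum_le (v := v) (l := iterSubst σ k a)
    (t := (β - x) / 2 ^ (y - k * Real.logb 2 lam)) (div_nonneg (by linarith) hs.le) (by
      rw [sum_map_iterSubst hv, div_lt_iff₀ hs, two_rpow_sub_mul_logb hlam]
      have : lam ^ k * v a * (2 ^ y / lam ^ k) = v a * 2 ^ y := by
        have : lam ≠ 0 := by linarith
        field_simp
      linarith)
  rw [le_div_iff₀ hs] at h1
  rw [div_lt_iff₀ hs] at h2
  refine ⟨u, ⟨_, hw.symm⟩, ?_⟩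
  by_contra hne
  have h1' : x + (u.map v).sum * 2 ^ (y - k * Real.logb 2 lam) < β :=
    lt_of_le_of_ne (by linarith) (Ne.symm hne)
  obtain ⟨b, c, hbc, δ, hδ, hl, hr⟩ := hβ
  obtain ⟨r, hr0, hr1, hr2⟩ := exists_isDyadic_between (max_lt (sub_lt_self β hδ) h1')
  obtain ⟨r', hr0', hr1', hr2'⟩ := exists_isDyadic_between (lt_min (lt_add_of_pos_right β hδ)
    (show β < x + ((u.map v).sum + v e) * 2 ^ (y - k * Real.logb 2 lam) by linarith))
  obtain ⟨hr1, hr3⟩ := max_lt_iff.1 hr1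
  obtain ⟨hr2', hr3'⟩ := lt_min_iff.1 hr2'
  have e1 := hT.eq_of_iterSubst hlam hv0 hv hτ ha k hw hr3 (by linarith) hn hn'
  have e2 := hT.eq_of_iterSubst hlam hv0 hv hτ ha k hw (r := r') (by linarith) hr3' hn hn'
  exact hbc ((hl r hr0 hr1 hr2).symm.trans (e1.trans (e2.symm.trans (hr r' hr0' hr1' hr2'))))

end Tilings

/-! ### Strong aperiodicity of `Y_σ` -/

section YAperiodic

variable {A : Type*} {σ : A → List A} {lam : ℝ} {v : A → ℝ}
  {T : Set (A × ℝ × ℝ)} {τ : ℝ × ℝ → A}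

theorem IsChange.contract {n : ℤ} {β : ℝ} (h : IsChange τ n β) (i q : ℕ) (j : ℤ)
    (hper : ∀ r, IsDyadic r → ∀ n : ℤ, τ (j / 2 ^ i + r / 2 ^ q, ((n - q : ℤ) : ℝ)) = τ (r, n)) :
    IsChange τ ((n - q : ℤ) : ℝ) (j / 2 ^ i + β / 2 ^ q) := by
  obtain ⟨b, c, hbc, δ, hδ, hl, hr⟩ := h
  have h2 : (0 : ℝ) < 2 ^ q := by positivity
  have key (r : ℝ) (hr : IsDyadic r) :
      τ (r, ((n - q : ℤ) : ℝ)) = τ ((r - j / 2 ^ i) * 2 ^ q, n) := by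
    rw [← hper _ (hr.affine i q j)]
    congr 2
    field_simp
    ring
  have e : β / 2 ^ q * 2 ^ q = β := by field_simp
  have e' : δ / 2 ^ q * 2 ^ q = δ := by field_simp
  refine ⟨b, c, hbc, δ / 2 ^ q, by positivity, fun r hr' h3 h4 => ?_, fun r hr' h3 h4 => ?_⟩
  · rw [key r hr']
    refine hl _ (hr'.affine i q j) ?_ ?_
    · rw [← e, ← e', ← sub_mul]; exact mul_lt_mul_of_pos_right (by linarith) h2
    · rw [← e]; exact mul_lt_mul_of_pos_right (by linarith) h2
  · rw [key r hr']
    refine hr _ (hr'.affine i q j) ?_ ?_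
    · rw [← e]; exact mul_lt_mul_of_pos_right (by linarith) h2
    · rw [← e, ← e', ← add_mul]; exact mul_lt_mul_of_pos_right (by linarith) h2

/-- Writing positions relative to the fixed point `c` turns the affine contraction into division by
`2 ^ q`. -/
theorem IsChange.contract_iterate {n : ℤ} {β c : ℝ} (h : IsChange τ n β) {i q : ℕ} {j : ℤ}
    (hper : ∀ r, IsDyadic r → ∀ n : ℤ, τ (j / 2 ^ i + r / 2 ^ q, ((n - q : ℤ) : ℝ)) = τ (r, n))
    (hc : j / 2 ^ i + c / 2 ^ q = c) (m : ℕ) :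
    IsChange τ ((n - q * m : ℤ) : ℝ) (c + (β - c) / 2 ^ (q * m)) := by
  induction m with
  | zero => simpa using h
  | succ m ih =>
    have := ih.contract i q j hper
    convert this using 1
    · push_cast; ring
    · rw [add_div, ← add_assoc, hc, div_div, ← pow_add]
      rfl

theorem exists_int_between {y L : ℝ} (hL : 1 < L) : ∃ n : ℤ, y - L < n ∧ (n : ℝ) < y :=
  ⟨⌈y⌉ - 1, by push_cast; linarith [Int.le_ceil y], by push_cast; linarith [Int.ceil_lt_add_one y]⟩

theorem UniqueSize.three_le_logb (hs : UniqueSize lam v) : 3 ≤ Real.logb 2 lam := by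
  rw [Real.le_logb_iff_rpow_le (by norm_num) (by linarith [hs.1])]
  exact le_trans (by norm_num) hs.1

variable [Fintype A] [DecidableEq A] [Nontrivial A]

/-- Next to the common edge of two tiles wider than `x0` with different letters, the translation by
`x0` moves a point from one tile to the other. -/
theorem IsTiling.not_translation_invariant (hT : IsTiling σ lam v T) (hσ : IsPrimitive σ)
    (hv : IsExpanding σ lam v) (hs : UniqueSize lam v)
    (hτ : ∀ z, ∃ p ∈ T, z ∈ tile lam v p ∧ τ z = p.1) {x0 : ℝ} (hx0 : 0 < x0)
    (hper : ∀ r, IsDyadic r → ∀ n : ℤ, τ (x0 + r, n) = τ (r, n)) : False := by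
  obtain ⟨k, hk⟩ := hσ.exists_adjacent_ne
  obtain ⟨N, hN⟩ := exists_nat_gt x0
  set L := Real.logb 2 lam with hL
  have hL3 : 3 ≤ L := hs.three_le_logb
  -- A tile this high still has scale at least `2 ^ N > x0` after `k` rows.
  obtain ⟨⟨a, x, y⟩, hP, hz⟩ := Set.mem_iUnion₂.1
    (hT.cover.symm ▸ Set.mem_univ ((0 : ℝ), (N : ℝ) + k * L))
  have hy : (N : ℝ) + k * L ≤ y := hz.2.2
  obtain ⟨u, d, e, u', hw, hde⟩ := hk a
  obtain ⟨n, hn, hn'⟩ := exists_int_between (y := y - k * L) (L := L) (by linarith)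
  have hsc : x0 < (2 : ℝ) ^ (y - k * L) := by
    calc x0 < (N : ℝ) := hN
      _ ≤ 2 ^ N := by exact_mod_cast Nat.lt_two_pow_self.le
      _ = (2 : ℝ) ^ (N : ℝ) := (Real.rpow_natCast _ _).symm
      _ ≤ _ := Real.rpow_le_rpow_of_exponent_le (by norm_num) (by linarith)
  have hpos : (0 : ℝ) < 2 ^ (y - k * L) := hx0.trans hsc
  have hd : x0 < v d * 2 ^ (y - k * L) := by nlinarith [hs.2 d]
  have he : x0 < v e * 2 ^ (y - k * L) := by nlinarith [hs.2 e]
  obtain ⟨r, hr, h1, h2⟩ := exists_isDyadic_between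
    (sub_lt_self (x + ((u.map v).sum + v d) * 2 ^ (y - k * L)) hx0)
  have e1 := hT.eq_of_iterSubst hv.1 hv.2.1 hv.sum_map hτ hP k hw (r := r) (n := n)
    (by linarith) h2 (by linarith) hn'
  have e2 := hT.eq_of_iterSubst hv.1 hv.2.1 hv.sum_map hτ hP k (u := u ++ [d]) (u' := u') (b := e)
    (by simpa using hw) (r := x0 + r) (n := n)
    (by simp only [List.map_append, List.sum_append, List.map_cons, List.map_nil, List.sum_cons,
          List.sum_nil]
        linarith)
    (by simp only [List.map_append, List.sum_append, List.map_cons, List.map_nil, List.sum_cons,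
          List.sum_nil]
        linarith) (by linarith) hn'
  exact hde (e1.symm.trans ((hper r hr n).symm.trans e2))

/-- Two changes are followed rather than one because their distance does not involve the left end of
the tile: it is a word length times the scale of the row. -/
theorem IsTiling.not_contraction_invariant (hT : IsTiling σ lam v T) (hσ : IsPrimitive σ)
    (hv : IsExpanding σ lam v) (hs : UniqueSize lam v) (hirr : Irrational (Real.logb 2 lam))
    (hτ : ∀ z, ∃ p ∈ T, z ∈ tile lam v p ∧ τ z = p.1) {i q : ℕ} {j : ℤ} (hq : 0 < q)
    (hper : ∀ r, IsDyadic r → ∀ n : ℤ, τ (j / 2 ^ i + r / 2 ^ q, ((n - q : ℤ) : ℝ)) = τ (r, n)) :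
    False := by
  obtain ⟨k, hk⟩ := hσ.exists_two_adjacent_ne
  set L := Real.logb 2 lam with hL
  have hL3 : 3 ≤ L := hs.three_le_logb
  obtain ⟨c, hc⟩ : ∃ c : ℝ, j / 2 ^ i + c / 2 ^ q = c := by
    have h1 : (1 : ℝ) < 2 ^ q := one_lt_pow₀ one_lt_two hq.ne'
    refine ⟨j / 2 ^ i * 2 ^ q / (2 ^ q - 1), ?_⟩
    have h2 : (2 : ℝ) ^ q - 1 ≠ 0 := by linarith
    field_simp
    ring
  obtain ⟨⟨a, x, y⟩, hP, hz⟩ := Set.mem_iUnion₂.1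
    (hT.cover.symm ▸ Set.mem_univ (c, (0 : ℝ)))
  have hx1 : x ≤ c := hz.1.1
  have hx2 : c ≤ x + v a * 2 ^ y := hz.1.2
  obtain ⟨u, d, e, w, d', e', u', hw, hde, hde'⟩ := hk a
  obtain ⟨n, hn, hn'⟩ := exists_int_between (y := y - k * L) (L := L) (by linarith)
  set s : ℝ := 2 ^ (y - k * L) with hsdef
  have hs0 : 0 < s := Real.rpow_pos_of_pos two_pos _
  have hvpos : ∀ l : List A, 0 ≤ (l.map v).sum := fun l =>
    (Nat.cast_nonneg _).trans (length_le_sum_map (fun a => by linarith [hs.2 a]) l)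
  have hα := hT.isChange hv.1 hv.2.1 hv.sum_map hτ hP k (u := u) (b := d) (c := e)
    (u' := w ++ d' :: e' :: u') (by simpa using hw) hde (n := n) (by linarith) hn'
  have hβ := hT.isChange hv.1 hv.2.1 hv.sum_map hτ hP k (u := u ++ d :: e :: w) (b := d') (c := e')
    (u' := u') hw hde' (n := n) (by linarith) hn'
  rw [← hL, ← hsdef] at hα hβ
  set α := x + ((u.map v).sum + v d) * s with hαdef
  set β := x + (((u ++ d :: e :: w).map v).sum + v d') * s with hβdef
  have hxα : x ≤ α := by
    rw [hαdef]; linarith [mul_nonneg (add_nonneg (hvpos u) (hv.2.1 d).le) hs0.le]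
  have hαβ : α < β := by
    rw [hαdef, hβdef]
    have : (u.map v).sum + v d < ((u ++ d :: e :: w).map v).sum + v d' := by
      simp only [List.map_append, List.sum_append, List.map_cons, List.sum_cons]
      linarith [hvpos w, hv.2.1 e, hv.2.1 d']
    linarith [mul_lt_mul_of_pos_right this hs0]
  have hβx : β < x + v a * 2 ^ y := by
    have h1 := sum_map_iterSubst hv.sum_map k a
    have h2 : v a * 2 ^ y = ((iterSubst σ k a).map v).sum * s := by
      rw [h1, hsdef, hL, two_rpow_sub_mul_logb hv.1]
      have : lam ≠ 0 := by linarith [hv.1]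
      field_simp
    rw [h2, hβdef, hw]
    refine add_lt_add_right (mul_lt_mul_of_pos_right ?_ hs0) _
    rw [List.map_append (l₁ := u ++ _), List.sum_append]
    simp only [List.map_cons, List.sum_cons]
    linarith [hvpos u', hv.2.1 e']
  -- beyond some power of the contraction, the images avoid the edges of the rows
  obtain ⟨m₀, hm₀⟩ : ∃ m₀ : ℕ, ∀ m ≥ m₀, ∀ k' : ℕ, (k' : ℝ) * L ≠ y - (n - q * m : ℤ) := by
    by_contra! hbad
    -- Two bad exponents `m₁ < m₂` would make an integer multiple of `L` equal to `q * (m₂ - m₁) ≠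
    -- 0`, so at most one is bad.
    obtain ⟨m₁, -, k₁, h₁⟩ := hbad 0
    obtain ⟨m₂, hm, k₂, h₂⟩ := hbad (m₁ + 1)
    have h3 : ((k₂ - k₁ : ℤ) : ℝ) * L = ((q * (m₂ - m₁) : ℤ) : ℝ) := by
      push_cast at h₁ h₂ ⊢
      linarith
    rcases mul_eq_zero.1 (eq_zero_of_irrational hirr h3) with h | h <;> omega
  set C := (β - α) * 2 ^ (-y - q * m₀) with hC
  have hCpos : 0 < C := mul_pos (by linarith) (Real.rpow_pos_of_pos two_pos _)
  set J := ⌈(β - α) * 2 ^ (-(n : ℝ))⌉₊ with hJ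
  refine pigeonhole_of_irrational hirr (q := -q) (by omega) hCpos
    (F := (fun l : List A => (l.map v).sum) '' {l | l.length ≤ J})
    ((List.finite_length_le A J).image _) fun m' => ?_
  set m := m₀ + m' with hm
  have hg := hm₀ m (by omega)
  have hqm : (0 : ℝ) < 2 ^ (q * m) := by positivity
  have hqm1 : (1 : ℝ) ≤ 2 ^ (q * m) := one_le_pow₀ one_le_two
  set nm : ℤ := n - q * m with hnm
  have hnn : (nm : ℝ) ≤ n := by
    rw [hnm]; push_cast; linarith [mul_nonneg (Nat.cast_nonneg (α := ℝ) q) (Nat.cast_nonneg m)]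
  have hkL : (0 : ℝ) ≤ k * L := by positivity
  set km := ⌊(y - nm) / L⌋₊ with hkm
  have hk1 : (km : ℝ) * L ≤ y - nm := by
    rw [← le_div_iff₀ (by linarith)]
    exact Nat.floor_le (div_nonneg (by linarith) (by linarith))
  have hk2 : y - nm < (km + 1) * L := by
    rw [← div_lt_iff₀ (by linarith)]
    exact Nat.lt_floor_add_one _
  have hk3 : (nm : ℝ) < y - km * L := by
    have := lt_of_le_of_ne hk1 (hg km)
    linarith
  -- The images stay under the tile by convexity, since `c` lies in its horizontal extent.
  have hin (γ : ℝ) (h1 : x ≤ γ) (h2 : γ < x + v a * 2 ^ y) :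
      x ≤ c + (γ - c) / 2 ^ (q * m) ∧ c + (γ - c) / 2 ^ (q * m) < x + v a * 2 ^ y := by
    constructor
    · have : x - c ≤ (γ - c) / 2 ^ (q * m) := by
        rw [le_div_iff₀ hqm]; nlinarith
      linarith
    · have : (γ - c) / 2 ^ (q * m) < x + v a * 2 ^ y - c := by
        rw [div_lt_iff₀ hqm]; nlinarith
      linarith
  obtain ⟨p, hp, hpα⟩ := hT.exists_prefix_of_isChange hv.1 hv.2.1 hv.sum_map hτ hP km
    (by linarith) hk3 (hα.contract_iterate hper hc m) (hin α hxα (hαβ.trans hβx)).1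
    (hin α hxα (hαβ.trans hβx)).2
  obtain ⟨p', hp', hpβ⟩ := hT.exists_prefix_of_isChange hv.1 hv.2.1 hv.sum_map hτ hP km
    (by linarith) hk3 (hβ.contract_iterate hper hc m) (hin β (hxα.trans hαβ.le) hβx).1
    (hin β (hxα.trans hαβ.le) hβx).2
  rw [← hL] at hpα hpβ
  have hsm : (0 : ℝ) < 2 ^ (y - km * L) := Real.rpow_pos_of_pos two_pos _
  have hdiff : (β - α) / 2 ^ (q * m) = ((p'.map v).sum - (p.map v).sum) * 2 ^ (y - km * L) := by
    have : (β - α) / 2 ^ (q * m) = (β - c) / 2 ^ (q * m) - (α - c) / 2 ^ (q * m) := by ring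
    rw [this]
    linarith
  have hdpos : 0 < (β - α) / 2 ^ (q * m) := div_pos (by linarith) hqm
  obtain ⟨l, rfl⟩ : p <+: p' := by
    rcases List.prefix_or_prefix_of_prefix hp hp' with h | ⟨l, rfl⟩
    · exact h
    · rw [hdiff, List.map_append, List.sum_append] at hdpos
      have := pos_of_mul_pos_left hdpos hsm.le
      linarith [hvpos l]
  have hl : (l.map v).sum = C * 2 ^ (((-q : ℤ) : ℝ) * m' + (km : ℤ) * L) := by
    rw [List.map_append, List.sum_append, add_sub_cancel_left] at hdiff
    have e1 : (l.map v).sum = (β - α) / 2 ^ (q * m) / 2 ^ (y - km * L) := by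
      rw [hdiff]; field_simp
    rw [e1, hC, div_div, mul_assoc, ← Real.rpow_natCast 2 (q * m), ← Real.rpow_add two_pos,
      ← Real.rpow_add two_pos, div_eq_mul_inv, ← Real.rpow_neg two_pos.le]
    congr 2
    rw [hm]
    push_cast
    ring
  refine ⟨km, l, ?_, hl⟩
  have h1 := length_le_sum_map (v := v) (fun a => by linarith [hs.2 a]) l
  -- The height `nm` lies below the top of row `km`, so the scale of that row is at least `2 ^ nm`;
  -- this bounds the word length independently of `m'`.
  have h2 : (l.map v).sum ≤ (β - α) * 2 ^ (-(n : ℝ)) := by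
    rw [hl, hC, mul_assoc, ← Real.rpow_add two_pos]
    refine mul_le_mul_of_nonneg_left (Real.rpow_le_rpow_of_exponent_le (by norm_num) ?_)
      (by linarith)
    have : (nm : ℝ) = n - q * (m₀ + m') := by rw [hnm, hm]; push_cast; ring
    push_cast
    linarith
  have h3 : (l.length : ℝ) ≤ J := (h1.trans h2).trans (Nat.le_ceil _)
  exact Nat.cast_le.1 h3

theorem exists_Phi_eq {r : ℝ} (hr : IsDyadic r) (n : ℤ) : ∃ g, Phi g = (r, (n : ℝ)) := by
  obtain ⟨i, j, rfl⟩ := hr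
  -- Adding `|n|` to the exponent of the denominator keeps the exponent of `t⁻¹` nonnegative.
  refine ⟨gt ^ (i + n.natAbs) * ga ^ (j * 2 ^ n.natAbs) * (gt ^ (i + n.natAbs + n).toNat)⁻¹, ?_⟩
  rw [Phi_normalForm]
  have h : (((i + n.natAbs + n).toNat : ℤ) : ℝ) = ((i + n.natAbs + n : ℤ) : ℝ) := by
    rw [Int.toNat_of_nonneg (by omega)]
  ext
  · push_cast
    rw [pow_add]
    field_simp
  · rw [Int.cast_natCast] at h
    rw [h]
    simp only [Int.cast_add, Int.cast_natCast, Nat.cast_add]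
    ring

theorem Phi_normalForm_mul (i k : ℕ) (j : ℤ) (g : BS) :
    Phi (gt ^ i * ga ^ j * (gt ^ k)⁻¹ * g) =
      ((j + (Phi g).1 * 2 ^ k) / 2 ^ i, (Phi g).2 + k - i) := by
  simp only [Phi, map_mul, Equiv.Perm.mul_apply]
  rw [act_gt_inv_pow, act_ga_zpow, act_gt_pow]
  simp

theorem stronglyAperiodic_YSigma (hσ : IsPrimitive σ) (hv : IsExpanding σ lam v)
    (hs : UniqueSize lam v) (hirr : Irrational (Real.logb 2 lam)) :
    StronglyAperiodic (YSigma σ lam v) := by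
  have key {y : BS → A} {τ : ℝ × ℝ → A} (hy : ∀ g, y g = τ (Phi (g * ga * gt))) (i k : ℕ) (j : ℤ)
      (hper : ∀ u, y (gt ^ i * ga ^ j * (gt ^ k)⁻¹ * u) = y u) (r : ℝ) (hr : IsDyadic r) (n : ℤ) :
      τ ((j + r * 2 ^ k) / 2 ^ i, (n : ℝ) + k - i) = τ (r, n) := by
    obtain ⟨g, hg⟩ := exists_Phi_eq hr n
    -- This argument absorbs the right factor `a t` in the definition of `Y_σ`.
    have h := hper (g * gt⁻¹ * ga⁻¹)
    rw [hy, hy] at h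
    simp only [inv_mul_cancel_right, ← mul_assoc] at h
    rwa [Phi_normalForm_mul, hg] at h
  refine stronglyAperiodic_of ?_ ?_
  · rintro y ⟨τ, ⟨T, hT, hτ⟩, hy⟩ i j hj hper
    refine hT.not_translation_invariant hσ hv hs hτ (x0 := j / 2 ^ i)
      (div_pos (Int.cast_pos.2 hj) (by positivity)) fun r hr n => ?_
    rw [← key hy i i j hper r hr n]
    congr 2
    · field_simp
    · ring
  · rintro y ⟨τ, ⟨T, hT, hτ⟩, hy⟩ i k j hki hper
    obtain ⟨q, rfl⟩ := Nat.exists_eq_add_of_lt hki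
    refine hT.not_contraction_invariant hσ hv hs hirr hτ (i := k + q + 1) (j := j) (q := q + 1)
      (by omega) fun r hr n => ?_
    rw [← key hy _ k j hper r hr n]
    congr 2
    · rw [add_assoc, pow_add]
      field_simp
    · push_cast
      ring

end YAperiodic

/-! ### Left ends of shaded zones -/

section Letters

variable {A : Type*} {m : ℕ}

/-- The shaded area of the letter `a` contributes `v a` to the letter that contains its left end. -/
def Letter.weight (v : A → ℝ) : Letter A m → ℝ
  | t1 _ _ a _ => v a
  | t2 a _ => v a
  | m1 a _ => v a
  | m2 _ _ a _ => v a
  | b1 a _ => v a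
  | _ => 0

/-- The letter contains the left end of a shaded area. -/
def Letter.IsStart : Letter A m → Prop
  | t1 .. | t2 .. | m1 .. | m2 .. | b1 .. => True
  | _ => False

/-- The letter contains the left end of a shaded area, which is a first one below another area if
the letter is a top letter. -/
def Letter.IsMarked : Letter A m → Prop
  | t1 _ _ _ i => (i : ℕ) = 0
  | t2 _ i => (i : ℕ) = 0
  | m1 .. | m2 .. | b1 .. => True
  | _ => False

/-- The weight of a horizontal edge: a left end of a shaded area lies on it if its right half only
is shaded. -/
def Color.weight (v : A → ℝ) : Color A m → ℝ
  | sndHalf a _ => v a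
  | _ => 0

/-- The edge is shaded on its right half only. -/
def Color.IsSnd : Color A m → Prop
  | sndHalf .. => True
  | _ => False

namespace Letter

theorem topEdge_eq_white_iff (l : Letter A m) : l.topEdge = .white ↔ l.kind = .top := by
  cases l <;> simp [topEdge, kind]

theorem weight_topEdge (v : A → ℝ) {l : Letter A m} (h : l.kind ≠ .top) :
    l.topEdge.weight v = l.weight v := by
  cases l <;> simp_all [topEdge, kind, weight, Color.weight]

theorem isSnd_topEdge {l : Letter A m} (h : l.kind ≠ .top) :
    l.topEdge.IsSnd ↔ l.IsMarked := by
  cases l <;> simp_all [topEdge, kind, IsMarked, Color.IsSnd]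

/-- In the colour table, a top or middle letter containing a left end has exactly one bottom edge
shaded on its right half only, with the same letter. -/
theorem weight_bot_add (v : A → ℝ) {l : Letter A m} (h : l.kind ≠ .bot) :
    l.botLeft.weight v + l.botRight.weight v = l.weight v := by
  cases l <;> simp_all [botLeft, botRight, kind, weight, Color.weight]

theorem isSnd_bot {l : Letter A m} (h : l.kind ≠ .bot) :
    l.botLeft.IsSnd ∨ l.botRight.IsSnd ↔ l.IsStart := by
  cases l <;> simp_all [botLeft, botRight, kind, IsStart, Color.IsSnd]

theorem bot_ne_white {l : Letter A m} (h : l.kind ≠ .bot) :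
    l.botLeft ≠ .white ∧ l.botRight ≠ .white := by
  cases l <;> simp_all [botLeft, botRight, kind]

theorem bot_eq_white {l : Letter A m} (h : l.kind = .bot) :
    l.botLeft = .white ∧ l.botRight = .white := by
  cases l <;> simp_all [botLeft, botRight, kind]

theorem IsMarked.isStart {l : Letter A m} (h : l.IsMarked) : l.IsStart := by
  cases l <;> simp_all [IsMarked, IsStart]

theorem isMarked_of_isStart {l : Letter A m} (h : l.IsStart) (hk : l.kind ≠ .top) :
    l.IsMarked := by
  cases l <;> simp_all [IsMarked, IsStart, kind]

theorem weight_eq_zero (v : A → ℝ) {l : Letter A m} (h : ¬ l.IsStart) : l.weight v = 0 := by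
  cases l <;> simp_all [IsStart, weight]

theorem IsStart.le_weight {v : A → ℝ} {r : ℝ} (hv : ∀ a, r ≤ v a) {l : Letter A m}
    (h : l.IsStart) : r ≤ l.weight v := by
  cases l <;> simp_all [IsStart, weight]

theorem weight_nonneg {v : A → ℝ} (hv : ∀ a, 0 ≤ v a) (l : Letter A m) : 0 ≤ l.weight v := by
  cases l <;> simp_all [weight]

theorem weight_le {v : A → ℝ} {V : ℝ} (h0 : 0 ≤ V) (hv : ∀ a, v a ≤ V) (l : Letter A m) :
    l.weight v ≤ V := by
  cases l <;> simp_all [weight]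

theorem weight_of_top (v : A → ℝ) {l : Letter A m} (h : l.kind = .top) :
    l.weight v = l.corner.elim 0 fun c => v c.1 := by
  cases l <;> simp_all [kind, weight, corner]

theorem isMarked_of_top {l : Letter A m} (h : l.kind = .top) :
    l.IsMarked ↔ ∃ c, l.corner = some (c, 0) := by
  cases l <;> simp_all [kind, IsMarked, corner]

theorem exists_eq_b1 {l : Letter A m} (h : l.IsStart) (hk : l.kind = .bot) :
    ∃ a i, l = .b1 a i := by
  cases l <;> simp_all [kind, IsStart]

theorem isStart_of_leftEdge_white {l : Letter A m} (h : l.leftEdge = .white) : l.IsStart := by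
  cases l <;> simp_all [leftEdge, IsStart]

/-- The letter contains the right end of a shaded area of a middle row. -/
def IsMidEnd : Letter A m → Prop
  | m4 .. | m5 .. => True
  | _ => False

theorem isStart_of_isMidEnd {l l' : Letter A m} (h : l.IsMidEnd) (hk : l'.kind = .mid)
    (hm : l.rightEdge = l'.leftEdge) : l'.IsStart := by
  cases l <;> simp_all only [IsMidEnd, rightEdge] <;>
    cases l' <;> simp_all [leftEdge, kind, IsStart]

theorem eq_m3_or_isMidEnd {a : A} {i : Fin m} {l' : Letter A m} (hk : l'.kind = .mid)
    (hm : (m3 a i).rightEdge = l'.leftEdge) : l' = .m3 a i ∨ l'.IsMidEnd := by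
  cases l' <;> simp_all [rightEdge, leftEdge, kind, IsMidEnd]

theorem mid_cases {l : Letter A m} (hk : l.kind = .mid) :
    l.IsStart ∨ l.IsMidEnd ∨ ∃ a i, l = .m3 a i := by
  cases l <;> simp_all [kind, IsStart, IsMidEnd]

end Letter

end Letters

/-! ### Weights of rows -/

section Rows

variable {A : Type*} {m : ℕ} {x : BS → Letter A m} {v : A → ℝ}

theorem mul_ga_pow_mul_gt (b : BS) (n : ℕ) : b * ga ^ n * gt = b * gt * ga ^ (2 * n) := by
  have := ga_zpow_mul_gt n
  rw [zpow_natCast, show (2 * (n : ℤ)) = ((2 * n : ℕ) : ℤ) by push_cast; rfl, zpow_natCast] at this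
  rw [mul_assoc, this, mul_assoc]

theorem UniformKind.kind_zpow (hU : UniformKind x) (b : BS) (k : ℤ) :
    (x (b * ga ^ k)).kind = (x b).kind := by
  induction k with
  | zero => simp
  | succ k ih => rw [zpow_add_one, ← mul_assoc, hU, ih]
  | pred k ih => rw [← ih, ← hU (b * ga ^ (-(k : ℤ) - 1)), zpow_sub_one, ← mul_assoc,
      inv_mul_cancel_right]

theorem UniformKind.kind_pow (hU : UniformKind x) (b : BS) (k : ℕ) :
    (x (b * ga ^ k)).kind = (x b).kind := by
  simpa using hU.kind_zpow b k

/-- The total weight of the letters in positions `b, b a, …, b aⁿ⁻¹`. -/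
def rowWeight (v : A → ℝ) (x : BS → Letter A m) (b : BS) (n : ℕ) : ℝ :=
  ∑ k ∈ Finset.range n, (x (b * ga ^ k)).weight v

theorem rowWeight_add (v : A → ℝ) (x : BS → Letter A m) (b : BS) (n k : ℕ) :
    rowWeight v x b (n + k) = rowWeight v x b n + rowWeight v x (b * ga ^ n) k := by
  simp only [rowWeight, Finset.sum_range_add, pow_add, mul_assoc]

theorem rowWeight_one (v : A → ℝ) (x : BS → Letter A m) (b : BS) :
    rowWeight v x b 1 = (x b).weight v := by
  simp [rowWeight]

theorem rowWeight_nonneg (hv : ∀ a, 0 ≤ v a) (b : BS) (n : ℕ) : 0 ≤ rowWeight v x b n :=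
  Finset.sum_nonneg fun _ _ => Letter.weight_nonneg hv _

theorem rowWeight_le {V : ℝ} (h0 : 0 ≤ V) (hv : ∀ a, v a ≤ V) (b : BS) (n : ℕ) :
    rowWeight v x b n ≤ n * V := by
  refine (Finset.sum_le_card_nsmul _ _ V fun _ _ => Letter.weight_le h0 hv _).trans ?_
  simp

open Classical in
/-- The offset of the position below `b` where the area that starts in `b` continues. -/
noncomputable def offset (x : BS → Letter A m) (b : BS) : ℕ :=
  if (x (b * gt)).IsMarked then 0 else 1

/-- The position below `b` where the area that starts in `b` continues. -/
noncomputable def below (x : BS → Letter A m) (b : BS) : BS := b * gt * ga ^ offset x b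

theorem offset_le_one (x : BS → Letter A m) (b : BS) : offset x b ≤ 1 := by
  unfold offset; split_ifs <;> simp

theorem offset_le (x : BS → Letter A m) (b : BS) (n : ℕ) :
    offset x b ≤ 2 * n + offset x (b * ga ^ n) := by
  rcases n with _ | n
  · simp
  · have := offset_le_one x b
    omega

theorem below_mul (x : BS → Letter A m) (b : BS) (n : ℕ) :
    below x b * ga ^ (2 * n + offset x (b * ga ^ n) - offset x b) = below x (b * ga ^ n) := by
  rw [below, below, mul_ga_pow_mul_gt, mul_assoc, ← pow_add, mul_assoc _ (ga ^ _), ← pow_add,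
    Nat.add_sub_cancel' (offset_le x b n)]

/-- The expansion between a row and the row below. -/
noncomputable def expansion (lam : ℝ) (x : BS → Letter A m) (b : BS) : ℝ :=
  open Classical in if (x b).kind = .bot then lam else 1

/-! ### Top and middle rows: matching preserves the weight. -/

section NotBot

variable (hM : Matching x) (hU : UniformKind x)
include hM

theorem Matching.kind_below_ne_top {b : BS} (hb : (x b).kind ≠ .bot) :
    (x (b * gt)).kind ≠ .top ∧ (x (b * gt * ga)).kind ≠ .top := by
  rw [Ne, Ne, ← Letter.topEdge_eq_white_iff, ← Letter.topEdge_eq_white_iff, ← (hM b).2.1,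
    ← (hM b).2.2]
  exact Letter.bot_ne_white hb

theorem Matching.weight_below {b : BS} (hb : (x b).kind ≠ .bot) :
    (x (b * gt)).weight v + (x (b * gt * ga)).weight v = (x b).weight v := by
  have h := hM.kind_below_ne_top hb
  rw [← Letter.weight_topEdge v h.1, ← Letter.weight_topEdge v h.2, ← (hM b).2.1, ← (hM b).2.2,
    Letter.weight_bot_add v hb]

theorem Matching.isMarked_below {b : BS} (hb : (x b).kind ≠ .bot) :
    (x (b * gt)).IsMarked ∨ (x (b * gt * ga)).IsMarked ↔ (x b).IsStart := by
  have h := hM.kind_below_ne_top hb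
  rw [← Letter.isSnd_topEdge h.1, ← Letter.isSnd_topEdge h.2, ← (hM b).2.1, ← (hM b).2.2,
    Letter.isSnd_bot hb]

theorem Matching.isStart_below {b : BS} (hb : (x b).kind ≠ .bot) (hs : (x b).IsStart) :
    (x (below x b)).IsStart := by
  unfold below offset
  split_ifs with h
  · simpa using h.isStart
  · simpa using (((hM.isMarked_below hb).2 hs).resolve_left h).isStart

/-- A letter skipped by the offset is unmarked; below a row without bottom letters this means that
it contains no left end. -/
theorem Matching.rowWeight_offset {b : BS} (hb : (x b).kind ≠ .bot) :
    rowWeight v x (b * gt) (offset x b) = 0 := by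
  unfold offset
  split_ifs with h
  · simp [rowWeight]
  · rw [rowWeight_one]
    exact Letter.weight_eq_zero v fun hs =>
      h (Letter.isMarked_of_isStart hs (hM.kind_below_ne_top hb).1)

include hU

theorem Matching.rowWeight_gt {b : BS} (hb : (x b).kind ≠ .bot) (n : ℕ) :
    rowWeight v x (b * gt) (2 * n) = rowWeight v x b n := by
  induction n with
  | zero => simp [rowWeight]
  | succ n ih =>
    have h := hM.weight_below (v := v) (b := b * ga ^ n) (by rwa [hU.kind_pow])
    rw [mul_ga_pow_mul_gt, mul_assoc _ _ ga, ← pow_succ] at h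
    rw [rowWeight, show 2 * (n + 1) = 2 * n + 1 + 1 by ring, Finset.sum_range_succ,
      Finset.sum_range_succ, add_assoc, h, rowWeight, Finset.sum_range_succ]
    exact congrArg (· + _) ih

/-- Shifting both ends of the doubled interval by their offsets only skips letters of weight zero.
-/
theorem Matching.rowWeight_below {b : BS} (hb : (x b).kind ≠ .bot) (n : ℕ) :
    rowWeight v x (below x b) (2 * n + offset x (b * ga ^ n) - offset x b) =
      rowWeight v x b n := by
  have h1 := rowWeight_add v x (b * gt) (offset x b) (2 * n + offset x (b * ga ^ n) - offset x b)
  rw [Nat.add_sub_cancel' (offset_le x b n), rowWeight_add, ← mul_ga_pow_mul_gt,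
    hM.rowWeight_offset hb, hM.rowWeight_offset (by rwa [hU.kind_pow]), hM.rowWeight_gt hU hb] at h1
  rw [below]
  linarith

end NotBot

theorem sum_filterMap_corner (v : A → ℝ) {l : List ℕ} {f : ℕ → Letter A m}
    (hf : ∀ k, (f k).kind = .top) :
    ((l.filterMap fun k => (f k).corner).map fun c => v c.1).sum =
      (l.map fun k => (f k).weight v).sum := by
  induction l with
  | nil => simp
  | cons k l ih =>
    rw [List.filterMap_cons, List.map_cons, List.sum_cons, Letter.weight_of_top v (hf k), ← ih]
    cases (f k).corner <;> simp

theorem sum_map_range' (f : ℕ → ℝ) (p n : ℕ) :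
    ((List.range' p n).map f).sum = ∑ k ∈ Finset.range n, f (p + k) := by
  induction n with
  | zero => simp
  | succ n ih => rw [List.range'_1_concat, List.map_append, List.sum_append, ih,
      Finset.sum_range_succ]; simp

theorem sum_map_zipIdx (v : A → ℝ) (l : List A) :
    (l.zipIdx.map fun c => v c.1).sum = (l.map v).sum := by
  rw [← Function.comp_def v, ← List.map_map, List.zipIdx_map_fst]

/-! ### Bottom rows: the substitution rule multiplies the weight by `lam`. -/

section Substitution

variable {σ : A → List A} {lam : ℝ} {h : ℕ} {hi : A → ℕ}
  (hM : Matching x) (hU : UniformKind x) (hS : SubstitutionRule σ h hi x)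
  (hv : ∀ a, ((σ a).map v).sum = lam * v a)
include hM hU

theorem Matching.kind_gt_of_bot {b : BS} (hb : (x b).kind = .bot) (k : ℕ) :
    (x (b * gt * ga ^ k)).kind = .top := by
  rw [hU.kind_pow, ← Letter.topEdge_eq_white_iff, ← (hM b).2.1]
  exact (Letter.bot_eq_white hb).1

/-- Below a bottom row all letters are top letters, and there a marked letter is exactly one whose
index is `0`. -/
theorem FirstBelow.eq_offset {b : BS} (hb : (x b).kind = .bot) {p : ℕ} (hp : FirstBelow x b p) :
    p = offset x b ∧ (x (below x b)).IsStart := by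
  have h0 := hp.2 0 (by omega)
  have h1 := hp.2 1 (by omega)
  rw [← Letter.isMarked_of_top (hM.kind_gt_of_bot hU hb _)] at h0 h1
  have hp2 := hp.1
  unfold below offset
  split_ifs with h
  · exact ⟨(h0.1 (by simpa using h)).symm, by simpa using h.isStart⟩
  · have : p = 1 := by
      by_contra h2
      exact h (by simpa using h0.2 (by omega))
    exact ⟨this, (h1.2 this.symm).isStart⟩

include hS hv

/-- The pattern `b1 b2 ⋯ b2 b3` has weight `v a` and the areas below it spell `σ a`, of weight `lam
* v a`. The white right edge of `b3` forces a new left end just after the pattern. -/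
theorem SubstitutionRule.exists_next {b : BS} (hb : (x b).kind = .bot) (hs : (x b).IsStart) :
    ∃ l, 0 < l ∧ (∀ k, 0 < k → k < l → ¬ (x (b * ga ^ k)).IsStart) ∧ (x (b * ga ^ l)).IsStart ∧
      (x (below x b)).IsStart ∧
      rowWeight v x (below x b) (2 * l + offset x (b * ga ^ l) - offset x b) =
        lam * rowWeight v x b l := by
  obtain ⟨a, i, ha⟩ := Letter.exists_eq_b1 hs hb
  obtain ⟨l, p, q, hl, -, hb2, hb3, hp, hq, hr⟩ := hS b a i ha
  obtain ⟨rfl, hst⟩ := FirstBelow.eq_offset hM hU hb hp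
  obtain ⟨rfl, -⟩ := FirstBelow.eq_offset hM hU (by rwa [hU.kind_pow]) hq
  have hne : ∀ k, 0 < k → k < l → ¬ (x (b * ga ^ k)).IsStart := by
    intro k hk hkl
    rcases Nat.lt_or_ge (k + 1) l with h1 | h1
    · rw [hb2 k hk h1]; simp [Letter.IsStart]
    · rw [show k = l - 1 by omega, hb3]; simp [Letter.IsStart]
  refine ⟨l, by omega, hne, ?_, hst, ?_⟩
  · refine Letter.isStart_of_leftEdge_white ?_
    have := (hM (b * ga ^ (l - 1))).1
    rw [hb3, mul_assoc, ← pow_succ, Nat.sub_add_cancel (by omega)] at this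
    exact this.symm
  · have h1 := congrArg (fun r => (r.map fun c => v c.1).sum) hr
    rw [sum_filterMap_corner v (f := fun k => x (b * gt * ga ^ k)) (hM.kind_gt_of_bot hU hb),
      sum_map_zipIdx, hv] at h1
    have h2 : rowWeight v x b l = v a := by
      rw [rowWeight, Finset.sum_eq_single_of_mem 0 (by simp; omega)]
      · rw [pow_zero, mul_one, ha]; rfl
      · intro k hk hk0
        exact Letter.weight_eq_zero v (hne k (by omega) (Finset.mem_range.1 hk))
    rw [h2, ← h1, below, rowWeight, sum_map_range']
    exact Finset.sum_congr rfl fun k _ => by rw [mul_assoc, ← pow_add]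

/-- This is the scaling law used throughout. In a bottom row, the interval between two left ends is
cut into successive areas, and the intervals below them fit together end to end. -/
theorem rowWeight_below {b : BS} (hs : (x b).IsStart) {n : ℕ} (hn : (x (b * ga ^ n)).IsStart) :
    (x (below x b)).IsStart ∧
      rowWeight v x (below x b) (2 * n + offset x (b * ga ^ n) - offset x b) =
        expansion lam x b * rowWeight v x b n := by
  by_cases hb : (x b).kind = .bot
  swap
  · rw [expansion, if_neg hb, one_mul]
    exact ⟨hM.isStart_below hb hs, hM.rowWeight_below hU hb n⟩
  rw [expansion, if_pos hb]
  induction n using Nat.strong_induction_on generalizing b with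
  | _ n ih =>
  obtain ⟨l, hl, hne, hl', hst, hw⟩ := hS.exists_next hM hU hv hb hs
  refine ⟨hst, ?_⟩
  rcases Nat.eq_zero_or_pos n with rfl | hn0
  · simp [rowWeight]
  obtain ⟨k, rfl⟩ := Nat.exists_eq_add_of_le (not_lt.1 fun h => hne n hn0 h hn)
  rw [pow_add, ← mul_assoc] at hn ⊢
  have h2 := (ih k (by omega) hl' hn (by rwa [hU.kind_pow])).2
  have h3 := offset_le x b l
  have h4 := offset_le x (b * ga ^ l) k
  rw [show 2 * (l + k) + offset x (b * ga ^ l * ga ^ k) - offset x b =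
    (2 * l + offset x (b * ga ^ l) - offset x b) +
      (2 * k + offset x (b * ga ^ l * ga ^ k) - offset x (b * ga ^ l)) by omega,
    rowWeight_add, hw, below_mul, h2, rowWeight_add, mul_add]

end Substitution

/-! ### Existence of left ends -/

section Starts

variable {h : ℕ} {lo hi : A → ℕ} (hM : Matching x) (hU : UniformKind x) (hH : Heights h x)
  (hW : Widths lo hi x)
include hU hH

theorem Heights.kind_gt_of_top (hh : 2 ≤ h) {b : BS} (hb : (x b).kind = .top) (c : ℤ) :
    (x (b * gt * ga ^ c)).kind = .mid := by
  obtain ⟨n, hn, hk, -⟩ := hH.1 b hb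
  rw [hU.kind_zpow]
  simpa using hk 1 le_rfl (by omega)

include hM hW

/-- A run of `m3` has at most `hi a` letters here; the next letter is an `m4` or `m5`, and the one
after it contains a left end. -/
theorem exists_isStart_of_top (hh : 2 ≤ h) {H : ℕ} (hhi : ∀ a, hi a ≤ H) {b : BS}
    (hb : (x b).kind = .top) (c : ℤ) :
    ∃ r ≤ H + 1, (x (b * gt * ga ^ c * ga ^ r)).IsStart := by
  have hmid (r : ℕ) : (x (b * gt * ga ^ c * ga ^ r)).kind = .mid := by
    rw [hU.kind_pow]; exact hH.kind_gt_of_top hU hh hb c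
  have hnext (r : ℕ) (h : (x (b * gt * ga ^ c * ga ^ r)).IsMidEnd) :
      (x (b * gt * ga ^ c * ga ^ (r + 1))).IsStart := by
    refine Letter.isStart_of_isMidEnd h (hmid _) ?_
    rw [pow_succ, ← mul_assoc]
    exact (hM _).1
  -- Since `t a ^ (2 d) t⁻¹ = a ^ d`, an even `c` leads straight up to the row of `b`, and an odd
  -- one does so after one step back along `a`.
  have htop : InTopRow x (b * gt * ga ^ c) := by
    obtain ⟨d, hd | hd⟩ := Int.even_or_odd' c
    · left
      rw [hd, mul_assoc b, ← ga_zpow_mul_gt, ← mul_assoc, mul_inv_cancel_right, hU.kind_zpow, hb]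
    · right
      rw [hd, zpow_add_one, ← mul_assoc, mul_inv_cancel_right, mul_assoc b, ← ga_zpow_mul_gt,
        ← mul_assoc, mul_inv_cancel_right, hU.kind_zpow, hb]
  rcases Letter.mid_cases (hmid 0) with h | h | ⟨a, i, h⟩
  · exact ⟨0, by omega, h⟩
  · exact ⟨1, by omega, hnext 0 h⟩
  · have hex := (hW _ htop a i).2
    push Not at hex
    classical
    obtain ⟨hk, hk'⟩ := Nat.find_spec hex
    have hmin := fun k => Nat.find_min (m := k) hex
    have hH := hhi a
    generalize Nat.find hex = k at hk hk' hmin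
    obtain _ | k := k
    · exact (hk' h).elim
    refine ⟨k + 1 + 1, by omega, hnext _ ?_⟩
    have h3 : x (b * gt * ga ^ c * ga ^ k) = .m3 a i := by
      by_contra h3
      exact hmin k (by omega) ⟨by omega, h3⟩
    have h4 := (hM (b * gt * ga ^ c * ga ^ k)).1
    rw [mul_assoc _ (ga ^ k), ← pow_succ, h3] at h4
    exact (Letter.eq_m3_or_isMidEnd (hmid _) h4).resolve_left hk'

/-- By the rule on heights some row above is a top row. It has a left end, and left ends descend
from row to row. -/
theorem exists_isStart {σ : A → List A} {lam : ℝ} (hS : SubstitutionRule σ h hi x)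
    (hv : ∀ a, ((σ a).map v).sum = lam * v a) (hh : 2 ≤ h) {H : ℕ} (hhi : ∀ a, hi a ≤ H) (b : BS) :
    ∃ c : ℤ, (x (b * ga ^ c)).IsStart := by
  obtain ⟨d, hd⟩ : ∃ d : ℕ, (x (b * (gt ^ d)⁻¹)).kind = .top := by
    obtain ⟨k, hkh, hk⟩ := hH.2 (b * (gt ^ (h + 1))⁻¹)
    obtain ⟨d, hd⟩ := Nat.exists_eq_add_of_le hkh
    refine ⟨d, ?_⟩
    rwa [hd, pow_add, mul_inv_rev, ← mul_assoc, inv_mul_cancel_right] at hk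
  induction d generalizing b with
  | zero =>
    simp only [pow_zero, inv_one, mul_one] at hd
    obtain ⟨r, -, hr⟩ := exists_isStart_of_top hM hU hH hW hh hhi hd 0
    rw [zpow_zero, mul_one] at hr
    -- A left end found in the row below comes from one in the top row itself; the parity of `r`
    -- tells on which bottom edge it lies.
    obtain ⟨e, he | he⟩ := Nat.even_or_odd' r
    · refine ⟨e, ?_⟩
      have hb : (x (b * ga ^ e)).kind ≠ .bot := by rw [hU.kind_pow, hd]; simp
      rw [zpow_natCast, ← hM.isMarked_below hb]
      left
      rw [mul_ga_pow_mul_gt, ← he]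
      exact Letter.isMarked_of_isStart hr (by
        rw [he, ← mul_ga_pow_mul_gt]; exact (hM.kind_below_ne_top hb).1)
    · refine ⟨e, ?_⟩
      have hb : (x (b * ga ^ e)).kind ≠ .bot := by rw [hU.kind_pow, hd]; simp
      rw [zpow_natCast, ← hM.isMarked_below hb]
      right
      rw [mul_ga_pow_mul_gt, mul_assoc, ← pow_succ, ← he]
      exact Letter.isMarked_of_isStart hr (by
        rw [he, pow_succ, ← mul_assoc, ← mul_ga_pow_mul_gt]; exact (hM.kind_below_ne_top hb).2)
  | succ d ih =>
    have e : b * (gt ^ (d + 1))⁻¹ = b * gt⁻¹ * (gt ^ d)⁻¹ := by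
      rw [pow_succ, mul_inv_rev, ← mul_assoc]
    rw [e] at hd
    obtain ⟨c, hc⟩ := ih (b * gt⁻¹) hd
    have h1 := (rowWeight_below hM hU hS hv hc (n := 0) (by simpa using hc)).1
    refine ⟨2 * c + offset x (b * gt⁻¹ * ga ^ c), ?_⟩
    rwa [below, mul_assoc _ (ga ^ c), ga_zpow_mul_gt, ← mul_assoc, inv_mul_cancel_right, mul_assoc,
      ← zpow_natCast, ← zpow_add] at h1

end Starts

end Rows

/-! ### Strong aperiodicity of `X_σ` -/

section XAperiodic

variable {A : Type*} {m : ℕ} {x : BS → Letter A m} {v : A → ℝ}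

/-- The conjugate of `a ^ J` by `u` is the square of its conjugate by `u t`, so going up keeps the
same `J`. -/
theorem period_of_period_gt {u : BS} {J : ℕ} (hJ : ∀ w, x (u * gt * ga ^ J * w) = x (u * gt * w))
    (w : BS) : x (u * ga ^ J * w) = x (u * w) := by
  have h1 : u * ga ^ J = u * gt * ga ^ J * ga ^ J * gt⁻¹ := by
    rw [eq_mul_inv_iff_mul_eq, mul_ga_pow_mul_gt, two_mul, pow_add, mul_assoc _ (ga ^ J)]
  rw [h1, mul_assoc, mul_assoc (u * gt * ga ^ J), hJ, ← mul_assoc, hJ, ← mul_assoc,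
    mul_inv_cancel_right]

theorem rowWeight_ga_zpow {u : BS} {J : ℕ} (hJ : ∀ w, x (u * ga ^ J * w) = x (u * w)) (c : ℤ) :
    rowWeight v x (u * ga ^ c) J = rowWeight v x u J := by
  have step (c : ℤ) : rowWeight v x (u * ga ^ (c + 1)) J = rowWeight v x (u * ga ^ c) J := by
    have h1 := rowWeight_add v x (u * ga ^ c) J 1
    have h2 := rowWeight_add v x (u * ga ^ c) 1 J
    have h3 : x (u * ga ^ c * ga ^ J) = x (u * ga ^ c) := by
      rw [← hJ (ga ^ c), mul_assoc, mul_assoc, ← zpow_natCast, ← zpow_add, ← zpow_add, add_comm]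
    rw [rowWeight_one, h3] at h1
    rw [add_comm 1 J, rowWeight_one, pow_one, mul_assoc, ← zpow_add_one] at h2
    linarith
  induction c with
  | zero => simp
  | succ c ih => rw [step, ih]
  | pred c ih => rw [← ih, ← step (-(c : ℤ) - 1), sub_add_cancel]

theorem rowWeight_period {u : BS} {J : ℕ} (hJ : ∀ w, x (u * ga ^ J * w) = x (u * w)) (c : ℤ) :
    rowWeight v x (u * ga ^ c) (2 * J) = 2 * rowWeight v x u J := by
  rw [two_mul, rowWeight_add, mul_assoc, ← zpow_natCast, ← zpow_add, rowWeight_ga_zpow hJ,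
    rowWeight_ga_zpow hJ, two_mul]

theorem rowWeight_pos (hv : ∀ a, 0 < v a) {u : BS} {J : ℕ} (hJ0 : 0 < J)
    (hJ : ∀ w, x (u * ga ^ J * w) = x (u * w)) {c : ℤ} (hc : (x (u * ga ^ c)).IsStart) :
    0 < rowWeight v x u J := by
  obtain ⟨J, rfl⟩ := Nat.exists_eq_add_of_le hJ0
  rw [← rowWeight_ga_zpow hJ c, Nat.succ_eq_add_one, zero_add, rowWeight_add, rowWeight_one]
  refine add_pos_of_pos_of_nonneg ?_ (rowWeight_nonneg (fun a => (hv a).le) _ _)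
  revert hc
  cases x (u * ga ^ c) <;> simp [Letter.IsStart, Letter.weight, hv]

theorem finite_rowWeight [Finite A] (v : A → ℝ) (J : ℕ) :
    {w | ∃ (x : BS → Letter A m) (u : BS), rowWeight v x u J = w}.Finite := by
  refine (Set.finite_range fun f : Fin J → Letter A m => ∑ i, (f i).weight v).subset ?_
  rintro _ ⟨x, u, rfl⟩
  exact ⟨fun i => x (u * ga ^ (i : ℕ)),
    (Finset.sum_range fun k => (x (u * ga ^ k)).weight v).symm⟩

theorem expansion_eq_pow (lam : ℝ) (x : BS → Letter A m) (b : BS) :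
    ∃ k : ℕ, expansion lam x b = lam ^ k := by
  unfold expansion
  split_ifs
  · exact ⟨1, (pow_one _).symm⟩
  · exact ⟨0, (pow_zero _).symm⟩

/-- Left ends of shaded areas occur in the row of `b` in any `K + 1` consecutive positions. -/
def DenseStarts (x : BS → Letter A m) (K : ℕ) (b : BS) : Prop :=
  ∀ c : ℤ, ∃ r ≤ K, (x (b * ga ^ c * ga ^ r)).IsStart

/-- Jump from one left end to the next: each jump covers at most `K + 1` positions and collects
weight at least `1`. -/
theorem DenseStarts.le_rowWeight (hv1 : ∀ a, 1 ≤ v a) {K : ℕ} {b : BS} (hK : DenseStarts x K b)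
    {c : ℤ} (hc : (x (b * ga ^ c)).IsStart) (n : ℕ) :
    (n : ℝ) ≤ (K + 1) * rowWeight v x (b * ga ^ c) n := by
  induction n using Nat.strong_induction_on generalizing c with
  | _ n ih =>
  rcases Nat.eq_zero_or_pos n with rfl | hn0
  · simp [rowWeight]
  have h0 (b : BS) (n : ℕ) : 0 ≤ rowWeight v x b n :=
    rowWeight_nonneg (fun a => zero_le_one.trans (hv1 a)) b n
  have h1 : ∀ k, 1 ≤ rowWeight v x (b * ga ^ c) (1 + k) := fun k => by
    rw [rowWeight_add, rowWeight_one]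
    linarith [hc.le_weight hv1, h0 (b * ga ^ c * ga ^ 1) k]
  obtain ⟨r, hr, hs⟩ := hK (c + 1)
  have hrK : (r : ℝ) ≤ K := by exact_mod_cast hr
  rcases Nat.lt_or_ge n (1 + r) with hn | hn
  · obtain ⟨k, rfl⟩ := Nat.exists_eq_add_of_le (Nat.succ_le_of_lt hn0)
    have h2 : ((Nat.succ 0 + k : ℕ) : ℝ) ≤ K := by
      exact_mod_cast (show Nat.succ 0 + k ≤ K by omega)
    have h3 := h1 k
    have h4 : (K : ℝ) + 1 ≤ (K + 1) * rowWeight v x (b * ga ^ c) (1 + k) := by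
      nlinarith [Nat.cast_nonneg (α := ℝ) K]
    exact h2.trans (by linarith)
  · obtain ⟨k, rfl⟩ := Nat.exists_eq_add_of_le hn
    have e : b * ga ^ (c + 1) * ga ^ r = b * ga ^ (c + (1 + r : ℕ)) := by
      rw [mul_assoc, ← zpow_natCast, ← zpow_add]; push_cast; rw [add_assoc]
    rw [e] at hs
    have h2 := ih k (by omega) hs
    have h3 := h1 r
    rw [rowWeight_add, mul_assoc, ← zpow_natCast, ← zpow_add]
    push_cast at *
    nlinarith [Nat.cast_nonneg (α := ℝ) K]

/-! ### Periods against the scaling of weights. -/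

section

variable {σ : A → List A} {lam : ℝ} {h : ℕ} {lo hi : A → ℕ}
  (hM : Matching x) (hU : UniformKind x) (hH : Heights h x) (hW : Widths lo hi x)
  (hS : SubstitutionRule σ h hi x) (hv : ∀ a, ((σ a).map v).sum = lam * v a)
include hM hU hS hv

/-- The `J` positions of one period in the row of `u` lie above `2 J` positions, that is, two
periods of the row below. -/
theorem rowWeight_gt_of_period {u : BS} {J : ℕ}
    (hJ : ∀ w, x (u * gt * ga ^ J * w) = x (u * gt * w)) {c : ℤ} (hc : (x (u * ga ^ c)).IsStart) :
    2 * rowWeight v x (u * gt) J = expansion lam x u * rowWeight v x u J := by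
  have hJu := period_of_period_gt hJ
  have hJc (w : BS) : x (u * ga ^ c * ga ^ J * w) = x (u * ga ^ c * w) := by
    rw [mul_assoc u, ← zpow_natCast, ← zpow_add, add_comm, zpow_add, zpow_natCast,
      ← mul_assoc, mul_assoc _ (ga ^ c), hJu, mul_assoc]
  have h1 := (rowWeight_below hM hU hS hv hc (n := J) (by
    have := hJc 1
    rw [mul_one, mul_one] at this
    rwa [this])).2
  have h2 : offset x (u * ga ^ c * ga ^ J) = offset x (u * ga ^ c) := by
    rw [offset, offset, hJc]
  have h3 : expansion lam x (u * ga ^ c) = expansion lam x u := by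
    rw [expansion, expansion, hU.kind_zpow]
  rwa [h2, Nat.add_sub_cancel, below, h3, rowWeight_ga_zpow hJu, mul_assoc u, ga_zpow_mul_gt,
    ← mul_assoc, mul_assoc _ (ga ^ _), ← zpow_natCast, ← zpow_add, rowWeight_period hJ] at h1

/-- One row down, `n` becomes `2 n - 1`, `2 n` or `2 n + 1`. Hence `n - 1` at least doubles and `n +
1` at most doubles, which gives both bounds and explains `2 ≤ n₀`. -/
theorem exists_iterate_below {u : BS} {c₀ : ℤ} {n₀ : ℕ} (hn : 2 ≤ n₀)
    (h1 : (x (u * ga ^ c₀)).IsStart) (h2 : (x (u * ga ^ c₀ * ga ^ n₀)).IsStart) (r : ℕ) :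
    ∃ (c : ℤ) (n : ℕ), (x (u * gt ^ r * ga ^ c)).IsStart ∧
      (x (u * gt ^ r * ga ^ c * ga ^ n)).IsStart ∧ 2 ^ r + 1 ≤ n ∧ n + 1 ≤ 2 ^ r * (n₀ + 1) ∧
      rowWeight v x (u * gt ^ r * ga ^ c) n =
        (∏ i ∈ Finset.range r, expansion lam x (u * gt ^ i)) *
          rowWeight v x (u * ga ^ c₀) n₀ := by
  induction r with
  | zero => exact ⟨c₀, n₀, by simpa using h1, by simpa using h2, by simpa using hn, by simp, by simp⟩
  | succ r ih =>
    obtain ⟨c, n, hc, hcn, hn1, hn2, hw⟩ := ih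
    set b := u * gt ^ r * ga ^ c with hb
    have hb' : below x b = u * gt ^ (r + 1) * ga ^ (2 * c + offset x b) := by
      rw [below, hb, mul_assoc _ (ga ^ c), ga_zpow_mul_gt, ← mul_assoc, mul_assoc u, ← pow_succ,
        mul_assoc, zpow_add, zpow_natCast]
    obtain ⟨h3, h4⟩ := rowWeight_below hM hU hS hv hc hcn
    have h5 := rowWeight_below hM hU hS hv hcn (n := 0) (by simpa using hcn)
    refine ⟨2 * c + offset x b, 2 * n + offset x (b * ga ^ n) - offset x b, ?_⟩
    rw [← hb', below_mul]
    have h6 := offset_le_one x b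
    have h7 := offset_le_one x (b * ga ^ n)
    refine ⟨h3, h5.1, ?_, ?_, ?_⟩
    · rw [pow_succ]; omega
    · rw [pow_succ]
      have : 2 ^ r * 2 * (n₀ + 1) = 2 * (2 ^ r * (n₀ + 1)) := by ring
      omega
    · rw [h4, hw, Finset.prod_range_succ, hb, expansion, hU.kind_zpow, ← expansion]
      ring

include hH hW

/-- Climbing `N` rows multiplies the weight of a word of fixed length `J` by `2 ^ N / lam ^ k` for
some `k`. -/
theorem not_elliptic_period [Finite A] (hv0 : ∀ a, 0 < v a) (hlam : 1 < lam)
    (hirr : Irrational (Real.logb 2 lam)) (hh : 2 ≤ h) {H : ℕ} (hhi : ∀ a, hi a ≤ H) {u : BS}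
    {J : ℕ} (hJ0 : 0 < J) (hJ : ∀ w, x (u * ga ^ J * w) = x (u * w)) : False := by
  have hst := exists_isStart hM hU hH hW hS hv hh hhi
  have hgt (N : ℕ) : u * (gt ^ (N + 1))⁻¹ * gt = u * (gt ^ N)⁻¹ := by
    rw [pow_succ', mul_inv_rev, ← mul_assoc, inv_mul_cancel_right]
  have hper (N : ℕ) (w : BS) : x (u * (gt ^ N)⁻¹ * ga ^ J * w) = x (u * (gt ^ N)⁻¹ * w) := by
    induction N generalizing w with
    | zero => simpa using hJ w
    | succ N ih => exact period_of_period_gt (by rwa [hgt]) w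
  have hrec (N : ℕ) : ∃ k : ℕ, lam ^ k * rowWeight v x (u * (gt ^ N)⁻¹) J =
      2 ^ N * rowWeight v x u J := by
    induction N with
    | zero => exact ⟨0, by simp⟩
    | succ N ih =>
      obtain ⟨k, hk⟩ := ih
      obtain ⟨c, hc⟩ := hst (u * (gt ^ (N + 1))⁻¹)
      have h1 := rowWeight_gt_of_period hM hU hS hv (by rw [hgt]; exact hper N) hc
      obtain ⟨e, he⟩ := expansion_eq_pow lam x (u * (gt ^ (N + 1))⁻¹)
      rw [hgt, he] at h1
      refine ⟨k + e, ?_⟩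
      rw [pow_add, mul_assoc, ← h1, pow_succ', mul_assoc, ← hk]
      ring
  obtain ⟨c, hc⟩ := hst u
  refine pigeonhole_of_irrational hirr one_ne_zero (rowWeight_pos hv0 hJ0 hJ hc)
    (finite_rowWeight (m := m) v J) fun N => ?_
  obtain ⟨k, hk⟩ := hrec N
  refine ⟨-k, x, u * (gt ^ N)⁻¹, ?_⟩
  have h1 := two_rpow_sub_mul_logb hlam N k
  have h2 : (0 : ℝ) < lam ^ k := pow_pos (by linarith) k
  rw [Int.cast_one, one_mul, Int.cast_neg, neg_mul, Int.cast_natCast, ← sub_eq_add_neg, h1,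
    Real.rpow_natCast, mul_div_assoc', eq_div_iff h2.ne', mul_comm, hk, mul_comm]

/-- The rows at depths `q k` below `u` are translates of each other, so left ends have the same
density in all of them, while the weight per letter is governed by `ρ ^ k`. -/
theorem not_hyperbolic_period [Finite A] (hv1 : ∀ a, 1 ≤ v a) (hlam : 1 < lam)
    (hirr : Irrational (Real.logb 2 lam)) (hh : 2 ≤ h) {H : ℕ} (hhi : ∀ a, hi a ≤ H) {u : BS}
    {q : ℕ} (hq : 0 < q) {j : ℤ} (hper : ∀ w, x (u * gt ^ q * ga ^ j * w) = x (u * w)) : False := by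
  obtain ⟨s, -, hs⟩ := hH.2 u
  have hdense (c : ℤ) : ∃ r ≤ H + 1, (x (u * gt ^ (s + 1) * ga ^ c * ga ^ r)).IsStart := by
    rw [pow_succ, ← mul_assoc]
    exact exists_isStart_of_top hM hU hH hW hh hhi hs c
  -- The base point is moved to just below a top row, where left ends are dense; the exponent of `a`
  -- becomes `2 ^ (s + 1) * j`.
  have hper' (w : BS) : x (u * gt ^ (s + 1) * gt ^ q * ga ^ (2 ^ (s + 1) * j) * w) =
      x (u * gt ^ (s + 1) * w) := by
    rw [mul_assoc u, ← pow_add, add_comm, pow_add, ← mul_assoc, mul_assoc (u * gt ^ q),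
      ← ga_zpow_mul_gt_pow, ← mul_assoc, mul_assoc _ (gt ^ (s + 1)) w, hper, mul_assoc]
  generalize u * gt ^ (s + 1) = u at hdense hper'
  generalize 2 ^ (s + 1) * j = j at hper'
  have hshift (r : ℕ) (c : ℤ) (w : BS) :
      x (u * gt ^ (q + r) * ga ^ c * w) = x (u * gt ^ r * ga ^ (c - 2 ^ r * j) * w) := by
    have e : u * gt ^ (q + r) * ga ^ c * w =
        u * gt ^ q * ga ^ j * (gt ^ r * ga ^ (c - 2 ^ r * j) * w) := by
      simp only [← mul_assoc]
      rw [mul_assoc (u * gt ^ q), ga_zpow_mul_gt_pow, ← mul_assoc, mul_assoc _ (ga ^ _) (ga ^ _),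
        ← zpow_add, add_sub_cancel, pow_add, ← mul_assoc]
    rw [e, hper']
    simp only [mul_assoc]
  have hexp (r : ℕ) : expansion lam x (u * gt ^ (q + r)) = expansion lam x (u * gt ^ r) := by
    have := hshift r 0 1
    rw [zpow_zero, mul_one, mul_one, mul_one] at this
    rw [expansion, expansion, this, hU.kind_zpow]
  obtain ⟨J, hJ⟩ : ∃ J : ℕ, ∏ i ∈ Finset.range q, expansion lam x (u * gt ^ i) = lam ^ J := by
    generalize q = n
    induction n with
    | zero => exact ⟨0, by simp⟩
    | succ n ih =>
      obtain ⟨J, hJ⟩ := ih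
      obtain ⟨e, he⟩ := expansion_eq_pow lam x (u * gt ^ n)
      exact ⟨J + e, by rw [Finset.prod_range_succ, hJ, he, pow_add]⟩
  have hprod (k : ℕ) : ∏ i ∈ Finset.range (q * k), expansion lam x (u * gt ^ i) =
      (lam ^ J) ^ k := by
    induction k with
    | zero => simp
    | succ k ih =>
      rw [Nat.mul_succ, add_comm, Finset.prod_range_add, hJ]
      simp only [hexp]
      rw [ih, pow_succ']
  have hdense' (k : ℕ) : DenseStarts x (H + 1) (u * gt ^ (q * k)) := by
    induction k with
    | zero => simpa [DenseStarts] using hdense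
    | succ k ih =>
      intro c
      rw [Nat.mul_succ, add_comm (q * k)]
      simp only [hshift]
      exact ih _
  obtain ⟨r₀, -, hr₀⟩ := hdense 0
  rw [mul_assoc, ← zpow_natCast, ← zpow_add] at hr₀
  -- Searching two positions further makes the interval between the two left ends of length at least
  -- `2`.
  obtain ⟨r₁, -, hr₁⟩ := hdense (0 + r₀ + 2)
  have e1 : u * ga ^ ((0 : ℤ) + r₀ + 2) * ga ^ r₁ =
      u * ga ^ ((0 : ℤ) + r₀) * ga ^ (2 + r₁) := by
    rw [zpow_add _ _ 2, pow_add]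
    simp only [mul_assoc]
    rfl
  rw [e1] at hr₁
  have hit := exists_iterate_below hM hU hS hv (by omega) hr₀ hr₁
  set W₀ := rowWeight v x (u * ga ^ ((0 : ℤ) + r₀)) (2 + r₁) with hW₀
  obtain ⟨V, hV0, hV⟩ : ∃ V, 0 ≤ V ∧ ∀ a, v a ≤ V := by
    cases nonempty_fintype A
    have h0 := fun a => zero_le_one.trans (hv1 a)
    exact ⟨∑ a, v a, Finset.sum_nonneg fun a _ => h0 a, fun a =>
      Finset.single_le_sum (fun a _ => h0 a) (Finset.mem_univ a)⟩
  set ρ : ℝ := lam ^ J / 2 ^ q with hρ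
  have hlamJ : 0 < lam ^ J := pow_pos (by linarith) J
  have hρ0 : 0 < ρ := by positivity
  have hρk (k : ℕ) : (lam ^ J) ^ k = ρ ^ k * 2 ^ (q * k) := by
    rw [hρ, div_pow, ← pow_mul 2 q k, div_mul_cancel₀ _ (by positivity)]
  have hupper (k : ℕ) : ρ ^ k * W₀ ≤ (2 + r₁ + 1) * V := by
    obtain ⟨c, n, -, -, -, hn, hw⟩ := hit (q * k)
    rw [hprod, hρk] at hw
    have h1 := rowWeight_le (x := x) hV0 hV (u * gt ^ (q * k) * ga ^ c) n
    have h2 : (n : ℝ) ≤ 2 ^ (q * k) * (2 + r₁ + 1) := by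
      exact_mod_cast (show n ≤ 2 ^ (q * k) * (2 + r₁ + 1) by omega)
    have h3 : (2 : ℝ) ^ (q * k) * (ρ ^ k * W₀) ≤ 2 ^ (q * k) * ((2 + r₁ + 1) * V) := by
      calc (2 : ℝ) ^ (q * k) * (ρ ^ k * W₀) = rowWeight v x (u * gt ^ (q * k) * ga ^ c) n := by
            rw [hw]; ring
        _ ≤ n * V := h1
        _ ≤ _ := by rw [← mul_assoc]; exact mul_le_mul_of_nonneg_right h2 hV0
    exact le_of_mul_le_mul_left h3 (by positivity)
  have hlower (k : ℕ) : 1 ≤ (H + 2) * (ρ ^ k * W₀) := by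
    obtain ⟨c, n, hc, -, hn, -, hw⟩ := hit (q * k)
    rw [hprod, hρk] at hw
    have h1 := (hdense' k).le_rowWeight hv1 hc n
    have h2 : (2 : ℝ) ^ (q * k) ≤ n := by
      exact_mod_cast (show 2 ^ (q * k) ≤ n by omega)
    rw [hw] at h1
    push_cast at h1
    refine le_of_mul_le_mul_left (a := (2 : ℝ) ^ (q * k)) ?_ (by positivity)
    calc (2 : ℝ) ^ (q * k) * 1 ≤ n := by linarith
      _ ≤ _ := h1
      _ = _ := by ring
  have hW₀pos : 0 < W₀ := by
    have := hlower 0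
    rw [pow_zero, one_mul] at this
    by_contra hneg
    nlinarith [Nat.cast_nonneg (α := ℝ) H]
  -- If `ρ < 1` the lower bound fails for large `k`, and if `ρ > 1` the upper one does.
  have hρ1 : ρ = 1 := by
    rcases lt_trichotomy ρ 1 with h | h | h
    · obtain ⟨k, hk⟩ := exists_pow_lt_of_lt_one (y := ρ)
        (show 0 < 1 / ((H + 2) * W₀) by positivity) h
      rw [lt_div_iff₀ (by positivity)] at hk
      linarith [hlower k]
    · exact h
    · obtain ⟨k, hk⟩ := pow_unbounded_of_one_lt ((2 + r₁ + 1) * V / W₀) h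
      rw [div_lt_iff₀ hW₀pos] at hk
      linarith [hupper k]
  rw [hρ, div_eq_one_iff_eq (by positivity)] at hρ1
  have h1 := congrArg (Real.logb 2) hρ1
  rw [Real.logb_pow, Real.logb_pow, Real.logb_self_eq_one (by norm_num), mul_one] at h1
  have h2 := eq_zero_of_irrational hirr (z := J) (w := q) (by exact_mod_cast h1)
  omega

end

theorem stronglyAperiodic_XSigma {A : Type*} [Fintype A] [DecidableEq A] {σ : A → List A}
    {lam : ℝ} {v : A → ℝ} (hv : IsExpanding σ lam v)
    (hs : UniqueSize lam v) (hirr : Irrational (Real.logb 2 lam)) (lo hi : A → ℕ) :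
    StronglyAperiodic (XSigma σ lam lo hi) := by
  -- From `lam ≥ 8` the logarithm is at least `3`; then `h - 1 ≥ 1`, so a middle row follows every
  -- top row.
  have hh : 2 ≤ ⌊Real.logb 2 lam⌋₊ - 1 := by
    have : 3 ≤ ⌊Real.logb 2 lam⌋₊ := Nat.le_floor (by exact_mod_cast hs.three_le_logb)
    omega
  have hhi (a : A) : hi a ≤ ∑ b, hi b := Finset.single_le_sum (fun _ _ => Nat.zero_le _)
    (Finset.mem_univ a)
  refine stronglyAperiodic_of ?_ ?_
  · rintro x ⟨hM, hU, hH, hW, -, hS⟩ i j hj hper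
    obtain ⟨J, rfl⟩ := Int.eq_ofNat_of_zero_le hj.le
    refine not_elliptic_period hM hU hH hW hS hv.sum_map hv.2.1 hv.1 hirr hh hhi (u := gt ^ i)
      (J := J) (by omega) fun w => ?_
    rw [← hper (gt ^ i * w), zpow_natCast, ← mul_assoc, inv_mul_cancel_right]
  · rintro x ⟨hM, hU, hH, hW, -, hS⟩ i k j hki hper
    obtain ⟨q, rfl⟩ := Nat.exists_eq_add_of_lt hki
    refine not_hyperbolic_period hM hU hH hW hS hv.sum_map
      (fun a => by linarith [hs.2 a]) hv.1 hirr hh hhi (u := gt ^ k) (q := q + 1) (j := j)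
      (by omega) fun w => ?_
    rw [← hper (gt ^ k * w), ← mul_assoc, inv_mul_cancel_right, add_assoc, pow_add gt k]

end XAperiodic

end SigmaShift

theorem mainTheorem4 {A : Type*} [Fintype A] [DecidableEq A] [Nontrivial A]
    (σ : A → List A) (hσ : SigmaShift.IsPrimitive σ)
    (lam : ℝ) (v : A → ℝ) (hv : SigmaShift.IsExpanding σ lam v)
    (hs : SigmaShift.UniqueSize lam v) (hirr : Irrational (Real.logb 2 lam)) :
    SigmaShift.StronglyAperiodic (SigmaShift.YSigma σ lam v) ∧
    ∀ lo hi : A → ℕ,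
      SigmaShift.IsSFT (SigmaShift.XSigma σ lam lo hi) ∧
      SigmaShift.StronglyAperiodic (SigmaShift.XSigma σ lam lo hi) :=
  ⟨SigmaShift.stronglyAperiodic_YSigma hσ hv hs hirr, fun lo hi =>
    ⟨SigmaShift.isSFT_XSigma σ lam lo hi, SigmaShift.stronglyAperiodic_XSigma hv hs hirr lo hi⟩⟩
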